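/- For $N\ge 1$ and $\theta\in[0,1]$, the alternating-wells random walk is the discrete-time Markov chain on $\mathcal X_N=[-2N,2N]\cap\mathbb Z$, started at $0$, with the following transition probabilities. From $x\in[-N,N]\cap\mathbb Z$ it jumps to $x+1$ with probability $1-\theta$ and to $x-1$ with probability $\theta$; from $x\in([-2N+1,-N-1]\cup[N+1,2N-1])\cap\mathbb Z$ it jumps to $x+1$ with probability $\theta$ and to $x-1$ with probability $1-\theta$. The transition probabilities from the two states $\pm 2N$ are arbitrary. Let $\mathbb P_{0,\delta_\theta}$ and $\mathbb E_{0,\delta_\theta}$ denote the law of this chain and the corresponding expectation, and let $\tau_N$ be the first time the chain hits $\{-2N,2N\}$. Theorem. For every $\theta\in(0,1)\setminus\{1/2\}$ the hitting time $\tau_N$ is $\mathbb P_{0,\delta_\theta}$-almost surely finite with $\mathbb E_{0,\delta_\theta}[\tau_N]<\infty$ for every $N\ge1$, and $$\frac{\tau_N}{\mathbb E_{0,\delta_\theta}[\tau_N]}\;\underset{N\to\infty}{\longrightarrow}\;\mathrm{Exp}(1)\qquad\text{in distribution under }\mathbb P_{0,\delta_\theta};$$ that is, every such $\theta$ is metastable.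 -/

import Mathlib

open MeasureTheory ProbabilityTheory Filter Topology
open scoped ENNReal NNReal

noncomputable section

/-! ### Finite Markov chains on path space -/

/-- The one-step transition kernel of a row-stochastic matrix `Q` on a finite state space:
from `x`, the next state is `y` with probability `Q x y`. -/
def Markov.stepKernel {S : Type*} [Fintype S] [DecidableEq S] [MeasurableSpace S]
    [MeasurableSingletonClass S] (Q : Matrix.rowStochastic ℝ S) : Kernel S S :=
  Kernel.ofFunOfCountable fun x => ∑ y, ENNReal.ofReal (Q.1 x y) • Measure.dirac y

instance Markov.isMarkovKernel_stepKernel {S : Type*} [Fintype S] [DecidableEq S]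
    [MeasurableSpace S] [MeasurableSingletonClass S] (Q : Matrix.rowStochastic ℝ S) :
    IsMarkovKernel (Markov.stepKernel Q) := by
  refine ⟨fun x => ⟨?_⟩⟩
  have h := Matrix.mem_rowStochastic.1 Q.2
  have h1 : ∑ y, Q.1 x y = 1 := by
    have := congrFun h.2 x
    simpa [Matrix.mulVec, dotProduct] using this
  simp only [Markov.stepKernel, Kernel.ofFunOfCountable, Kernel.coe_mk, Measure.coe_finsetSum,
    Finset.sum_apply, Measure.smul_apply, measure_univ, smul_eq_mul, mul_one]
  rw [← ENNReal.ofReal_sum_of_nonneg fun y _ => h.1 x y, h1, ENNReal.ofReal_one]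

/-- The law, on the space of paths `ℕ → S`, of the time-homogeneous Markov chain with transition
matrix `Q` started at `x₀`: given the past up to time `n`, the state at time `n + 1` is drawn
from the row of `Q` indexed by the state at time `n`. -/
def Markov.chainLaw {S : Type*} [Fintype S] [DecidableEq S] [MeasurableSpace S]
    [MeasurableSingletonClass S] (Q : Matrix.rowStochastic ℝ S) (x₀ : S) : Measure (ℕ → S) :=
  Kernel.trajMeasure (X := fun _ => S) (Measure.dirac x₀) fun n =>
    (Markov.stepKernel Q).comap (fun h : (Finset.Iic n) → S => h ⟨n, Finset.mem_Iic.2 le_rfl⟩)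
      (measurable_pi_apply _)

instance Markov.isProbabilityMeasure_chainLaw {S : Type*} [Fintype S] [DecidableEq S]
    [MeasurableSpace S] [MeasurableSingletonClass S] (Q : Matrix.rowStochastic ℝ S) (x₀ : S) :
    IsProbabilityMeasure (Markov.chainLaw Q x₀) := by
  unfold Markov.chainLaw
  infer_instance

/-! ### The alternating-wells random walk -/

namespace AltWells

/-- The state space `[-2N, 2N] ∩ ℤ`. -/
abbrev State (N : ℕ) : Type := Set.Icc (-(2 * N : ℤ)) (2 * N : ℤ)

/-- The starting point `0`. -/
def origin (N : ℕ) : State N := ⟨0, by constructor <;> omega⟩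

/-- The target set `{-2N, 2N}`. -/
def target (N : ℕ) : Set (State N) := {x | (x : ℤ) = -(2 * N) ∨ (x : ℤ) = 2 * N}

open Classical in
/-- The entries of the transition matrix of the alternating-wells random walk. Off the target, the
walk moves by `±1`: on `[-N, N]` it goes right with probability `1 - θ` and left with probability
`θ`; on `[-2N + 1, -N - 1] ∪ [N + 1, 2N - 1]` it goes right with probability `θ` and left with
probability `1 - θ`. The rows of the two target states are those of `B`. -/
def entry (N : ℕ) (θ : ℝ) (B : Matrix (State N) (State N) ℝ) : Matrix (State N) (State N) ℝ :=
  fun x y =>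
    if x ∈ target N then B x y
    else if |(x : ℤ)| ≤ N then
      if (y : ℤ) = x + 1 then 1 - θ else if (y : ℤ) = x - 1 then θ else 0
    else
      if (y : ℤ) = x + 1 then θ else if (y : ℤ) = x - 1 then 1 - θ else 0

theorem sum_step {N : ℕ} {x : State N} (hx : x ∉ target N) (p q : ℝ) :
    ∑ y : State N, (if (y : ℤ) = x + 1 then p else if (y : ℤ) = x - 1 then q else 0) = p + q := by
  have hx2 := x.2
  simp only [target, Set.mem_ofPred_eq, not_or] at hx
  rw [Set.mem_Icc] at hx2
  let r : State N := ⟨x + 1, by constructor <;> omega⟩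
  let l : State N := ⟨x - 1, by constructor <;> omega⟩
  have hrl : r ≠ l := by
    intro h
    have := congrArg (fun z : State N => (z : ℤ)) h
    simp only [r, l] at this
    omega
  have : ∀ y : State N, (if (y : ℤ) = x + 1 then p else if (y : ℤ) = x - 1 then q else 0)
      = (if y = r then p else 0) + (if y = l then q else 0) := by
    intro y
    have h1 : y = r ↔ (y : ℤ) = x + 1 := Subtype.ext_iff
    have h2 : y = l ↔ (y : ℤ) = x - 1 := Subtype.ext_iff
    simp only [h1, h2]
    split_ifs <;> first | omega | simp
  simp [this, Finset.sum_add_distrib]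

/-- The transition matrix of the alternating-wells random walk, as a row-stochastic matrix. The
rows of the two target states are arbitrary: they are those of the stochastic matrix `B`. -/
def Q (N : ℕ) (θ : unitInterval) (B : Matrix.rowStochastic ℝ (State N)) :
    Matrix.rowStochastic ℝ (State N) :=
  ⟨entry N θ B.1, by
    have hB := Matrix.mem_rowStochastic.1 B.2
    have h0 := θ.2.1
    have h1 := θ.2.2
    refine Matrix.mem_rowStochastic.2 ⟨fun x y => ?_, funext fun x => ?_⟩
    · unfold entry
      split_ifs <;> first | exact hB.1 x y | linarith
    · simp only [Matrix.mulVec, dotProduct, Pi.one_apply, mul_one]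
      by_cases hx : x ∈ target N
      · have := congrFun hB.2 x
        simpa [Matrix.mulVec, dotProduct, entry, hx] using this
      · by_cases hN : |(x : ℤ)| ≤ N
        · simp only [entry, hx, hN, if_true, if_false]
          rw [sum_step hx]
          ring
        · simp only [entry, hx, hN, if_false]
          rw [sum_step hx]
          ring⟩

/-- The law `ℙ_{0,δ_θ}` of the alternating-wells random walk started at `0`. -/
def law (N : ℕ) (θ : unitInterval) (B : Matrix.rowStochastic ℝ (State N)) :
    Measure (ℕ → State N) :=
  Markov.chainLaw (Q N θ B) (origin N)

instance (N : ℕ) (θ : unitInterval) (B : Matrix.rowStochastic ℝ (State N)) :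
    IsProbabilityMeasure (law N θ B) :=
  Markov.isProbabilityMeasure_chainLaw _ _

/-- The first time `τ_N` at which a path hits `{-2N, 2N}` (`⊤` if it never does). -/
def τ (N : ℕ) (ω : ℕ → State N) : ℕ∞ :=
  hittingAfter (fun n (ω : ℕ → State N) => ω n) (target N) 0 ω

/-- The mean hitting time `𝔼_{0,δ_θ}[τ_N]`. -/
def mean (N : ℕ) (θ : unitInterval) (B : Matrix.rowStochastic ℝ (State N)) : ℝ≥0∞ :=
  ∫⁻ ω, (τ N ω : ℝ≥0∞) ∂(law N θ B)

end AltWells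

/-- The exponential distribution of rate one is a probability measure. -/
instance isProbabilityMeasure_expMeasure_one : IsProbabilityMeasure (expMeasure 1) :=
  isProbabilityMeasure_expMeasure one_pos

end

/-! Let `h` be the mean hitting time as a function of the starting point, so `h = 1 + P h` off the
target. Put `s n = ℙ(τ > n)` and `a n = 𝔼[h (X n); τ > n]`; then `a n = s n + a (n + 1)`. If `h`
were constant along the path up to time τ, then `a n = h x₀ * s n`, and τ would be exactly
geometric. In general the generating function satisfies `𝔼[z ^ τ] * ((1 - z) * h x₀ + z) = z + (1 -
z) ^ 2 * R`, where `R` is at most the expected sum of `|h (X n) - h x₀|` before τ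
(`Markov.exists_killedProb_generating`). A Lyapunov function `W ≥ 0` with `|h - h x₀| + P W ≤ W`
gives `‖R‖ ≤ W x₀`. At `z = exp (i t / h x₀)` the error is of order `W x₀ / h x₀ ^ 2`; when this
ratio tends to 0 and `h x₀` to infinity, the characteristic functions tend to `1 / (1 - i t)`, and
Lévy's continuity theorem concludes.

It remains to find `W` for the walk. By reflection take `θ < 1/2`. The drift then pushes `(-N, 2N)`
towards the well bottom `N`, and pushes the walk out to the left below `-N`. A function `V`
(`wellFun`), growing like `ρ ^ |x - N|` with `ρ = 2 (1 - θ) > 1` on `[-N, 2N]`, is superharmonic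
except at `N`. Comparison by the maximum principle shows that `h` exceeds `h N` by at most `O(N)`,
falls below it by at most `O(h N / ρ ^ N) * V`, and that `h 0` is comparable to `h N` and at least
of order `ρ ^ N`. A combination of `V` and `h` is therefore a valid `W`, with `W 0 / h 0 ^ 2 = O(N *
ρ ^ (-N))`. The base `ρ` need not be the sharp rate, since only this ratio matters. -/

/-! ### From path space to the killed chain -/

namespace Markov

/-- The paths which avoid `T` up to time `n`. -/
def avoid {S : Type*} (T : Set S) (n : ℕ) : Set (ℕ → S) := {ω | ∀ i ≤ n, ω i ∉ T}

theorem measurableSet_eval_eq {S : Type*} [MeasurableSpace S] [MeasurableSingletonClass S]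
    (n : ℕ) (x : S) : MeasurableSet {ω : ℕ → S | ω n = x} :=
  (measurableSet_singleton x).preimage (measurable_pi_apply n)

theorem measurableSet_avoid {S : Type*} [Finite S] [MeasurableSpace S]
    [MeasurableSingletonClass S] (T : Set S) (n : ℕ) : MeasurableSet (avoid T n) := by
  have : avoid T n = ⋂ i ∈ Set.Iic n, (fun ω : ℕ → S => ω i) ⁻¹' Tᶜ := by
    ext ω
    simp [avoid]
  rw [this]
  exact MeasurableSet.biInter (Set.to_countable _) fun i _ =>
    measurable_pi_apply i (Set.toFinite _).measurableSet

variable {S : Type*} [Fintype S] [DecidableEq S]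

open Classical in
/-- The probability that the chain with transition matrix `P` started at `x₀` sits at a given state
at time `n` without having visited `T` up to that time. -/
noncomputable def killedProb (P : Matrix S S ℝ) (T : Set S) (x₀ : S) : ℕ → S → ℝ
  | 0 => fun x => if x = x₀ then 1 else 0
  | n + 1 => fun y => if y ∈ T then 0 else ∑ x, killedProb P T x₀ n x * P x y

variable [MeasurableSpace S] [MeasurableSingletonClass S]

theorem stepKernel_singleton (Q : Matrix.rowStochastic ℝ S) (x y : S) :
    stepKernel Q x {y} = ENNReal.ofReal (Q.1 x y) := by
  simp only [stepKernel, Kernel.ofFunOfCountable, Kernel.coe_mk, Measure.coe_finsetSum,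
    Finset.sum_apply, Measure.smul_apply, smul_eq_mul]
  rw [Finset.sum_eq_single y]
  · simp
  · intro b _ hb
    simp [hb]
  · simp

theorem ae_chainLaw_zero (Q : Matrix.rowStochastic ℝ S) (x₀ : S) :
    ∀ᵐ ω ∂(chainLaw Q x₀), ω 0 = x₀ := by
  have h : (chainLaw Q x₀).map (Preorder.frestrictLe 0) =
      (Measure.dirac x₀).map (MeasurableEquiv.piUnique (fun _ : Finset.Iic 0 => S)).symm := by
    unfold chainLaw Kernel.trajMeasure
    rw [Measure.map_comp _ _ (by fun_prop), Kernel.traj_map_frestrictLe, Kernel.partialTraj_self,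
      Measure.id_comp]
  have h2 : ∀ᵐ z ∂((chainLaw Q x₀).map (Preorder.frestrictLe 0)),
      z ⟨0, Finset.mem_Iic.2 le_rfl⟩ = x₀ := by
    rw [h]
    refine (ae_map_iff (p := fun z : Finset.Iic 0 → S => z ⟨0, Finset.mem_Iic.2 le_rfl⟩ = x₀)
      (MeasurableEquiv.measurable _).aemeasurable
      (Set.toFinite _).measurableSet).2 ?_
    exact (ae_dirac_iff (measurableSet_singleton x₀)).2 rfl
  exact ae_of_ae_map (by fun_prop) h2

/-- This is the Markov property: the past event is a cylinder over times up to `n`, and on it the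
kernel for step `n + 1` is constant, because the current state is `x`. -/
theorem chainLaw_succ (Q : Matrix.rowStochastic ℝ S) (x₀ : S) (T : Set S) (n : ℕ) (x y : S) :
    (chainLaw Q x₀) (avoid T n ∩ {ω | ω n = x} ∩ {ω | ω (n + 1) = y}) =
      (chainLaw Q x₀) (avoid T n ∩ {ω | ω n = x}) * ENNReal.ofReal (Q.1 x y) := by
  let A : Set (Finset.Iic n → S) :=
    {z | (∀ i, z i ∉ T) ∧ z ⟨n, Finset.mem_Iic.2 le_rfl⟩ = x}
  have hA : MeasurableSet A := (Set.toFinite A).measurableSet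
  have hpre : Preorder.frestrictLe n ⁻¹' A = avoid T n ∩ {ω : ℕ → S | ω n = x} := by
    ext ω
    simp [A, avoid, Preorder.frestrictLe]
  have key := Kernel.map_frestrictLe_trajMeasure_compProd_eq_map_trajMeasure
    (X := fun _ => S) (μ₀ := Measure.dirac x₀) (a := n)
    (κ := fun n => (Markov.stepKernel Q).comap
      (fun h : (Finset.Iic n) → S => h ⟨n, Finset.mem_Iic.2 le_rfl⟩) (measurable_pi_apply _))
  have key2 := congrArg (fun μ => μ (A ×ˢ {y})) key
  beta_reduce at key2
  rw [Measure.compProd_apply_prod hA (measurableSet_singleton y),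
    Measure.map_apply (by fun_prop) (hA.prod (measurableSet_singleton y))] at key2
  have e1 : (fun ω : ℕ → S => (Preorder.frestrictLe (π := fun _ => S) n ω, ω (n + 1))) ⁻¹'
      (A ×ˢ {y}) = avoid T n ∩ {ω | ω n = x} ∩ {ω | ω (n + 1) = y} := by
    rw [← hpre]
    ext ω
    simp
  rw [e1] at key2
  unfold chainLaw
  rw [← key2, ← hpre, setLIntegral_congr_fun (g := fun _ => ENNReal.ofReal (Q.1 x y)) hA,
    setLIntegral_const, Measure.map_apply (by fun_prop) hA, mul_comm]
  intro z hz
  simp only [Kernel.comap_apply]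
  rw [hz.2, stepKernel_singleton]

theorem real_avoid_inter (Q : Matrix.rowStochastic ℝ S) (x₀ : S) (T : Set S) (h₀ : x₀ ∉ T)
    (n : ℕ) (x : S) :
    (chainLaw Q x₀).real (avoid T n ∩ {ω | ω n = x}) = killedProb Q.1 T x₀ n x := by
  have hQ := (Matrix.mem_rowStochastic.1 Q.2).1
  induction n generalizing x with
  | zero =>
    have h := ae_chainLaw_zero Q x₀
    by_cases hx : x = x₀
    · simp only [killedProb, hx, if_true]
      rw [measureReal_def, measure_congr (t := Set.univ), measure_univ, ENNReal.toReal_one]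
      refine eventuallyEq_univ.2 ?_
      filter_upwards [h] with ω hω
      exact ⟨fun i hi => by rw [Nat.le_zero.1 hi, hω]; exact h₀, hω⟩
    · simp only [killedProb, hx, if_false]
      rw [measureReal_eq_zero_iff, measure_eq_zero_iff_ae_notMem]
      filter_upwards [h] with ω hω h2
      exact hx (h2.2.symm.trans hω)
  | succ n ih =>
    by_cases hx : x ∈ T
    · simp only [killedProb, hx, if_true]
      have : avoid T (n + 1) ∩ {ω | ω (n + 1) = x} = ∅ := by
        ext ω
        simp only [avoid, Set.mem_inter_iff, Set.mem_ofPred_eq, Set.mem_empty_iff_false, iff_false]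
        rintro ⟨h1, h2⟩
        exact h1 (n + 1) le_rfl (h2 ▸ hx)
      rw [this, measureReal_empty]
    · simp only [killedProb, hx, if_false]
      have : avoid T (n + 1) ∩ {ω | ω (n + 1) = x} =
          ⋃ z, avoid T n ∩ {ω | ω n = z} ∩ {ω | ω (n + 1) = x} := by
        ext ω
        simp only [avoid, Set.mem_inter_iff, Set.mem_ofPred_eq, Set.mem_iUnion]
        constructor
        · rintro ⟨h1, h2⟩
          exact ⟨ω n, ⟨fun i hi => h1 i (hi.trans n.le_succ), rfl⟩, h2⟩
        · rintro ⟨z, ⟨h1, -⟩, h2⟩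
          refine ⟨fun i hi => ?_, h2⟩
          rcases Nat.le_succ_iff.1 hi with h | h
          · exact h1 i h
          · rw [h, h2]; exact hx
      rw [this, measureReal_iUnion_fintype]
      · refine Finset.sum_congr rfl fun z _ => ?_
        rw [← ih z, measureReal_def, chainLaw_succ, ENNReal.toReal_mul,
          ENNReal.toReal_ofReal (hQ z x), measureReal_def]
      · intro a b hab
        refine Set.disjoint_left.2 fun ω h1 h2 => hab (h1.1.2.symm.trans h2.1.2)
      · intro z
        exact ((measurableSet_avoid T n).inter (measurableSet_eval_eq n z)).inter
          (measurableSet_eval_eq _ x)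

theorem real_avoid (Q : Matrix.rowStochastic ℝ S) (x₀ : S) (T : Set S) (h₀ : x₀ ∉ T) (n : ℕ) :
    (chainLaw Q x₀).real (avoid T n) = ∑ x, killedProb Q.1 T x₀ n x := by
  have : avoid T n = ⋃ z, avoid T n ∩ {ω | ω n = z} := by
    ext ω; simp
  rw [this, measureReal_iUnion_fintype]
  · exact Finset.sum_congr rfl fun z _ => real_avoid_inter Q x₀ T h₀ n z
  · intro a b hab
    exact Set.disjoint_left.2 fun ω h1 h2 => hab (h1.2.symm.trans h2.2)
  · intro z
    exact (measurableSet_avoid T n).inter (measurableSet_eval_eq n z)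

end Markov

/-! ### Potential theory of the killed chain and its generating function -/

namespace Markov

section KilledExp

variable {S : Type*} [Fintype S] [DecidableEq S]

/-- The expectation of `F` at time `n` on the event that the chain has avoided `T`. -/
noncomputable def killedExp (P : Matrix S S ℝ) (T : Set S) (x₀ : S) (n : ℕ) (F : S → ℝ) : ℝ :=
  ∑ x, killedProb P T x₀ n x * F x

variable {P : Matrix S S ℝ} {T : Set S} {x₀ : S}

theorem killedProb_nonneg (hP : ∀ x y, 0 ≤ P x y) (n : ℕ) (x : S) :
    0 ≤ killedProb P T x₀ n x := by
  induction n generalizing x with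
  | zero => simp only [killedProb]; split_ifs <;> norm_num
  | succ n ih =>
    simp only [killedProb]
    split_ifs
    · exact le_rfl
    · exact Finset.sum_nonneg fun y _ => mul_nonneg (ih y) (hP y x)

theorem killedProb_of_mem (h₀ : x₀ ∉ T) (n : ℕ) {x : S} (hx : x ∈ T) :
    killedProb P T x₀ n x = 0 := by
  cases n with
  | zero => simp only [killedProb]; rw [if_neg]; rintro rfl; exact h₀ hx
  | succ n => simp [killedProb, hx]

/-- The killed mass vanishes on `T`, also at time 0 since the start lies outside; hence inequalities
are needed only off `T`. -/
theorem killedExp_mono (hP : ∀ x y, 0 ≤ P x y) (h₀ : x₀ ∉ T) (n : ℕ) {F G : S → ℝ}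
    (h : ∀ x ∉ T, F x ≤ G x) : killedExp P T x₀ n F ≤ killedExp P T x₀ n G := by
  refine Finset.sum_le_sum fun x _ => ?_
  by_cases hx : x ∈ T
  · simp [killedProb_of_mem h₀ n hx]
  · exact mul_le_mul_of_nonneg_left (h x hx) (killedProb_nonneg hP n x)

theorem killedExp_congr (hP : ∀ x y, 0 ≤ P x y) (h₀ : x₀ ∉ T) (n : ℕ) {F G : S → ℝ}
    (h : ∀ x ∉ T, F x = G x) : killedExp P T x₀ n F = killedExp P T x₀ n G :=
  le_antisymm (killedExp_mono hP h₀ n fun x hx => (h x hx).le)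
    (killedExp_mono hP h₀ n fun x hx => (h x hx).ge)

theorem killedExp_add (n : ℕ) (F G : S → ℝ) :
    killedExp P T x₀ n (F + G) = killedExp P T x₀ n F + killedExp P T x₀ n G := by
  simp [killedExp, mul_add, Finset.sum_add_distrib]

theorem killedExp_const (n : ℕ) (c : ℝ) :
    killedExp P T x₀ n (fun _ => c) = c * ∑ x, killedProb P T x₀ n x := by
  simp [killedExp, Finset.mul_sum, mul_comm]

theorem killedExp_zero (F : S → ℝ) : killedExp P T x₀ 0 F = F x₀ := by
  simp [killedExp, killedProb]

theorem killedExp_nonneg (hP : ∀ x y, 0 ≤ P x y) (n : ℕ) {F : S → ℝ} (h : ∀ x, 0 ≤ F x) :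
    0 ≤ killedExp P T x₀ n F :=
  Finset.sum_nonneg fun x _ => mul_nonneg (killedProb_nonneg hP n x) (h x)

/-- Killing discards exactly the mass that enters `T`, a loss invisible to a function vanishing
there. For a function that is merely nonnegative on `T`, as in the next lemma, the loss leaves an
inequality. -/
theorem killedExp_succ (n : ℕ) {u : S → ℝ} (hu : ∀ x ∈ T, u x = 0) :
    killedExp P T x₀ (n + 1) u = killedExp P T x₀ n (P.mulVec u) := by
  have h : ∀ y, killedProb P T x₀ (n + 1) y * u y = ∑ x, killedProb P T x₀ n x * (P x y * u y) := by
    intro y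
    by_cases hy : y ∈ T
    · simp [hu y hy]
    · simp only [killedProb, hy, if_false, Finset.sum_mul, mul_assoc]
  simp only [killedExp, h, Matrix.mulVec, dotProduct, Finset.mul_sum]
  exact Finset.sum_comm

theorem killedExp_succ_le (hP : ∀ x y, 0 ≤ P x y) (n : ℕ) {u : S → ℝ} (hu : ∀ x ∈ T, 0 ≤ u x) :
    killedExp P T x₀ (n + 1) u ≤ killedExp P T x₀ n (P.mulVec u) := by
  have h : ∀ y, killedProb P T x₀ (n + 1) y * u y ≤ ∑ x, killedProb P T x₀ n x * (P x y * u y) := by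
    intro y
    by_cases hy : y ∈ T
    · simp only [killedProb, hy, if_true, zero_mul]
      exact Finset.sum_nonneg fun x _ => mul_nonneg (killedProb_nonneg hP n x)
        (mul_nonneg (hP x y) (hu y hy))
    · simp only [killedProb, hy, if_false, Finset.sum_mul, mul_assoc, le_refl]
  refine (Finset.sum_le_sum fun y _ => h y).trans_eq ?_
  simp only [killedExp, Matrix.mulVec, dotProduct, Finset.mul_sum]
  exact Finset.sum_comm

/-- A nonnegative function `W` whose drift is at most `-F` off `T` bounds the total mass of `F`
collected before `T` is reached. -/
theorem sum_killedExp_le (hP : ∀ x y, 0 ≤ P x y) (h₀ : x₀ ∉ T) {F W : S → ℝ}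
    (hW : ∀ x, 0 ≤ W x) (h : ∀ x ∉ T, F x + P.mulVec W x ≤ W x) (n : ℕ) :
    ∑ k ∈ Finset.range n, killedExp P T x₀ k F ≤ W x₀ := by
  -- Keeping the remaining mass of `W` on the left makes the bound inductive; it is dropped at the
  -- end by nonnegativity.
  have key : ∑ k ∈ Finset.range n, killedExp P T x₀ k F + killedExp P T x₀ n W ≤ W x₀ := by
    induction n with
    | zero => simp [killedExp_zero]
    | succ n ih =>
      have h1 := killedExp_succ_le (T := T) (x₀ := x₀) hP n (u := W) fun x _ => hW x
      have h2 := killedExp_mono hP h₀ n (F := F + P.mulVec W) (G := W) h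
      rw [killedExp_add] at h2
      rw [Finset.sum_range_succ]
      linarith
  have := killedExp_nonneg (T := T) (x₀ := x₀) hP n hW
  linarith

theorem sum_killedProb_add (hP : ∀ x y, 0 ≤ P x y) (h₀ : x₀ ∉ T) {h : S → ℝ}
    (hT : ∀ x ∈ T, h x = 0) (hh : ∀ x ∉ T, h x = 1 + P.mulVec h x) (n : ℕ) :
    killedExp P T x₀ n h = ∑ x, killedProb P T x₀ n x + killedExp P T x₀ (n + 1) h := by
  rw [killedExp_succ n hT, ← one_mul (∑ x, killedProb P T x₀ n x), ← killedExp_const,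
    ← killedExp_add]
  exact killedExp_congr hP h₀ n hh

/-- If `h` solves the Poisson equation `h = 1 + P h` off `T` with `h = 0` on `T`, then the
probabilities of avoiding `T` sum to `h x₀`. -/
theorem hasSum_killedProb (hP : ∀ x y, 0 ≤ P x y) (h₀ : x₀ ∉ T) {h : S → ℝ} (h_nonneg : ∀ x, 0 ≤ h x)
    (hT : ∀ x ∈ T, h x = 0) (hh : ∀ x ∉ T, h x = 1 + P.mulVec h x) :
    HasSum (fun n => ∑ x, killedProb P T x₀ n x) (h x₀) ∧
      Tendsto (fun n => killedExp P T x₀ n h) atTop (𝓝 0) := by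
  set s : ℕ → ℝ := fun n => ∑ x, killedProb P T x₀ n x with hs
  have hs0 : ∀ n, 0 ≤ s n := fun n => Finset.sum_nonneg fun x _ => killedProb_nonneg hP n x
  have hsum : ∀ n, ∑ k ∈ Finset.range n, s k + killedExp P T x₀ n h = h x₀ := by
    intro n
    induction n with
    | zero => simp [killedExp_zero]
    | succ n ih =>
      rw [Finset.sum_range_succ, ← ih, sum_killedProb_add hP h₀ hT hh n]
      ring
  have hsm : Summable s := summable_of_sum_range_le hs0 fun n => by
    have := killedExp_nonneg (T := T) (x₀ := x₀) hP n h_nonneg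
    linarith [hsum n]
  -- On a finite state space the sum of the values of `h` bounds `h`, so the remainder is at most a
  -- constant times the summable survival probabilities.
  have hbd : ∀ x, h x ≤ ∑ y, h y := fun x =>
    Finset.single_le_sum (fun y _ => h_nonneg y) (Finset.mem_univ x)
  have hlim : Tendsto (fun n => killedExp P T x₀ n h) atTop (𝓝 0) := by
    refine squeeze_zero (fun n => killedExp_nonneg hP n h_nonneg) (fun n => ?_)
      (by simpa using hsm.tendsto_atTop_zero.const_mul (∑ y, h y))
    rw [← killedExp_const]
    exact killedExp_mono hP h₀ n fun x _ => hbd x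
  refine ⟨?_, hlim⟩
  rw [hasSum_iff_tendsto_nat_of_nonneg hs0]
  have : (fun n => ∑ k ∈ Finset.range n, s k) = fun n => h x₀ - killedExp P T x₀ n h := by
    funext n; linarith [hsum n]
  rw [this]
  simpa using tendsto_const_nhds.sub hlim

/-- The generating function of the time to reach `T`, up to an error controlled by the fluctuations
of the mean hitting time `h` along the path. -/
theorem exists_killedProb_generating (hP : ∀ x y, 0 ≤ P x y) (h₀ : x₀ ∉ T) {h W : S → ℝ}
    (h_nonneg : ∀ x, 0 ≤ h x) (hT : ∀ x ∈ T, h x = 0) (hh : ∀ x ∉ T, h x = 1 + P.mulVec h x)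
    (hW : ∀ x, 0 ≤ W x) (hhW : ∀ x ∉ T, |h x - h x₀| + P.mulVec W x ≤ W x)
    {z : ℂ} (hz : ‖z‖ ≤ 1) :
    ∃ R : ℂ, ‖R‖ ≤ W x₀ ∧
      (1 + (z - 1) * ∑' n, z ^ n * ((∑ x, killedProb P T x₀ n x : ℝ) : ℂ)) *
        ((1 - z) * h x₀ + z) = z + (1 - z) ^ 2 * R := by
  obtain ⟨hS, -⟩ := hasSum_killedProb hP h₀ h_nonneg hT hh
  have hstep := sum_killedProb_add hP h₀ hT hh
  set s : ℕ → ℝ := fun n => ∑ x, killedProb P T x₀ n x with hs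
  set a : ℕ → ℝ := fun n => killedExp P T x₀ n h with ha
  set b : ℕ → ℝ := fun n => killedExp P T x₀ n fun x => |h x - h x₀| with hb
  have hb0 : ∀ n, 0 ≤ b n := fun n => killedExp_nonneg hP n fun x => abs_nonneg _
  have hbs : Summable b := summable_of_sum_range_le hb0 fun n => sum_killedExp_le hP h₀ hW hhW n
  have hbW : ∑' n, b n ≤ W x₀ :=
    Real.tsum_le_of_sum_range_le hb0 fun n => sum_killedExp_le hP h₀ hW hhW n
  have hab : ∀ n, |a n - h x₀ * s n| ≤ b n := by
    intro n
    have : a n - h x₀ * s n = ∑ x, killedProb P T x₀ n x * (h x - h x₀) := by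
      simp only [ha, hs, killedExp, mul_sub, Finset.sum_sub_distrib, Finset.mul_sum]
      congr 1
      exact Finset.sum_congr rfl fun x _ => mul_comm _ _
    rw [this]
    refine (Finset.abs_sum_le_sum_abs _ _).trans_eq (Finset.sum_congr rfl fun x _ => ?_)
    rw [abs_mul, abs_of_nonneg (killedProb_nonneg hP n x)]
  have hzn : ∀ n, ‖z ^ n‖ ≤ 1 := fun n => by
    rw [norm_pow]; exact pow_le_one₀ (norm_nonneg z) hz
  have hzs : Summable fun n => z ^ n * (s n : ℂ) := by
    refine Summable.of_norm_bounded hS.summable fun n => ?_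
    rw [norm_mul, Complex.norm_real, Real.norm_of_nonneg
      (Finset.sum_nonneg fun x _ => killedProb_nonneg hP n x)]
    exact mul_le_of_le_one_left (Finset.sum_nonneg fun x _ => killedProb_nonneg hP n x) (hzn n)
  have hnb : ∀ n, ‖z ^ n * ((a n - h x₀ * s n : ℝ) : ℂ)‖ ≤ b n := fun n => by
    rw [norm_mul, Complex.norm_real, Real.norm_eq_abs]
    exact (mul_le_of_le_one_left (abs_nonneg _) (hzn n)).trans (hab n)
  have hzd : Summable fun n => z ^ n * ((a n - h x₀ * s n : ℝ) : ℂ) :=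
    Summable.of_norm_bounded hbs hnb
  set R := ∑' n, z ^ n * ((a n - h x₀ * s n : ℝ) : ℂ) with hR
  have hza : HasSum (fun n => z ^ n * (a n : ℂ)) (R + h x₀ * ∑' n, z ^ n * (s n : ℂ)) := by
    convert! hzd.hasSum.add (hzs.hasSum.mul_left (h x₀ : ℂ)) using 2 with n
    push_cast
    ring
  -- The telescoping sum equals `a 0 = h x₀`; the recurrence for `a` turns it into `(1 - z) * ∑ z ^
  -- n * a n + z * ∑ z ^ n * s n = h x₀`.
  have htel : HasSum (fun n => z ^ n * (a n : ℂ) - z ^ (n + 1) * (a (n + 1) : ℂ)) (h x₀) := by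
    have hsm : Summable (fun n => z ^ n * (a n : ℂ) - z ^ (n + 1) * (a (n + 1) : ℂ)) :=
      hza.summable.sub ((summable_nat_add_iff 1).2 hza.summable)
    refine (hsm.hasSum_iff_tendsto_nat).2 ?_
    simp only [Finset.sum_range_sub' (fun n => z ^ n * (a n : ℂ))]
    have : Tendsto (fun n => z ^ n * (a n : ℂ)) atTop (𝓝 0) := hza.summable.tendsto_atTop_zero
    simpa [ha, killedExp_zero] using tendsto_const_nhds.sub this
  have heq : (fun n => z ^ n * (a n : ℂ) - z ^ (n + 1) * (a (n + 1) : ℂ)) =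
      fun n => (1 - z) * (z ^ n * (a n : ℂ)) + z * (z ^ n * (s n : ℂ)) := by
    funext n
    have : (a n : ℂ) = s n + a (n + 1) := by exact_mod_cast hstep n
    rw [pow_succ, this]
    ring
  rw [heq] at htel
  have hmain := htel.unique ((hza.mul_left (1 - z)).add (hzs.hasSum.mul_left z))
  refine ⟨R, (tsum_of_norm_bounded hbs.hasSum hnb).trans hbW, ?_⟩
  -- With `S = ∑ z ^ n * s n` the identity reads `S * ((1 - z) * h x₀ + z) = h x₀ - (1 - z) * R`;
  -- multiplying by `z - 1` produces the second factor `1 - z` in the error.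
  linear_combination (1 - z) * hmain

end KilledExp

end Markov

/-! ### Tail sums and generating functions of integer-valued times -/

section WaitingTime

variable {Ω : Type*} [MeasurableSpace Ω] {μ : Measure Ω} {σ : Ω → ℕ∞}

theorem ENat.toENNReal_eq_tsum (k : ℕ∞) :
    (k : ℝ≥0∞) = ∑' n : ℕ, if (n : ℕ∞) < k then 1 else 0 := by
  induction k using ENat.recTopCoe with
  | top => simp
  | coe k =>
    rw [tsum_eq_sum (s := Finset.range k)]
    · simp [Finset.filter_true_of_mem]
    · intro n hn
      simpa using hn

theorem lintegral_toENNReal_eq_tsum (hσ : ∀ n : ℕ, MeasurableSet {ω | (n : ℕ∞) < σ ω}) :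
    ∫⁻ ω, (σ ω : ℝ≥0∞) ∂μ = ∑' n : ℕ, μ {ω | (n : ℕ∞) < σ ω} := by
  simp_rw [ENat.toENNReal_eq_tsum]
  rw [lintegral_tsum fun n =>
    (Measurable.ite (hσ n) measurable_const measurable_const).aemeasurable]
  refine tsum_congr fun n => ?_
  rw [← lintegral_indicator_one (hσ n)]
  simp only [Set.indicator_apply, Set.mem_ofPred_eq, Pi.one_apply]

theorem ENat.pow_toNat_eq (z : ℂ) {k : ℕ∞} (hk : k ≠ ⊤) :
    z ^ k.toNat = 1 + (z - 1) * ∑' n : ℕ, if (n : ℕ∞) < k then z ^ n else 0 := by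
  lift k to ℕ using hk
  rw [tsum_eq_sum (s := Finset.range k)]
  · have : ∑ n ∈ Finset.range k, (if (n : ℕ∞) < (k : ℕ∞) then z ^ n else 0) =
        ∑ n ∈ Finset.range k, z ^ n :=
      Finset.sum_congr rfl fun n hn => if_pos (by simpa using hn)
    rw [this, mul_geom_sum]
    simp
  · intro n hn
    exact if_neg (by simpa using hn)

theorem measurable_toNat_of_lt (hσ : ∀ n : ℕ, MeasurableSet {ω | (n : ℕ∞) < σ ω}) :
    Measurable fun ω => (σ ω).toNat := by
  have h : Measurable σ := by
    refine ENat.measurable_iff.2 fun n => ?_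
    have : σ ⁻¹' {(n : ℕ∞)} =
        (⋂ i ∈ Set.Iio n, {ω | (i : ℕ∞) < σ ω}) \ {ω | (n : ℕ∞) < σ ω} := by
      ext ω
      simp only [Set.mem_preimage, Set.mem_singleton_iff, Set.mem_sdiff, Set.mem_iInter,
        Set.mem_Iio, Set.mem_ofPred_eq, not_lt]
      constructor
      · intro h
        rw [h]
        exact ⟨fun i hi => by exact_mod_cast hi, le_rfl⟩
      · rintro ⟨h1, h2⟩
        refine le_antisymm h2 (le_of_not_gt fun h3 => ?_)
        lift σ ω to ℕ using (ne_top_of_lt h3) with m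
        exact lt_irrefl _ (h1 m (by exact_mod_cast h3))
    rw [this]
    exact (MeasurableSet.biInter (Set.to_countable _) fun i _ => hσ i).diff (hσ n)
  exact (measurable_of_countable ENat.toNat).comp h

theorem integral_pow_toNat [IsProbabilityMeasure μ] (hσ : ∀ n : ℕ, MeasurableSet {ω | (n : ℕ∞) < σ ω})
    (hfin : ∀ᵐ ω ∂μ, σ ω ≠ ⊤) (hs : Summable fun n : ℕ => μ.real {ω | (n : ℕ∞) < σ ω})
    {z : ℂ} (hz : ‖z‖ ≤ 1) :
    ∫ ω, z ^ (σ ω).toNat ∂μ =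
      1 + (z - 1) * ∑' n : ℕ, z ^ n * (μ.real {ω | (n : ℕ∞) < σ ω} : ℂ) := by
  have hind : ∀ n : ℕ, (fun ω => if (n : ℕ∞) < σ ω then z ^ n else 0) =
      {ω | (n : ℕ∞) < σ ω}.indicator fun _ => z ^ n := fun n => by
    funext ω
    simp only [Set.indicator_apply, Set.mem_ofPred_eq]
  have hint : ∀ n : ℕ, Integrable (fun ω => if (n : ℕ∞) < σ ω then z ^ n else 0) μ := fun n => by
    rw [hind]
    exact (integrable_const _).indicator (hσ n)
  have hval : ∀ n : ℕ, ∫ ω, (if (n : ℕ∞) < σ ω then z ^ n else 0) ∂μ =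
      z ^ n * (μ.real {ω | (n : ℕ∞) < σ ω} : ℂ) := fun n => by
    rw [hind, integral_indicator_const _ (hσ n), Complex.real_smul, mul_comm]
  have hnorm : Summable fun n : ℕ => ∫ ω, ‖if (n : ℕ∞) < σ ω then z ^ n else 0‖ ∂μ := by
    refine Summable.of_nonneg_of_le (fun n => integral_nonneg fun ω => norm_nonneg _)
      (fun n => ?_) hs
    have : (fun ω => ‖if (n : ℕ∞) < σ ω then z ^ n else 0‖) =
        {ω | (n : ℕ∞) < σ ω}.indicator fun _ => ‖z ^ n‖ := by
      funext ω
      simp only [Set.indicator_apply, Set.mem_ofPred_eq]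
      split_ifs <;> simp
    rw [this, integral_indicator_const _ (hσ n), smul_eq_mul]
    refine mul_le_of_le_one_right measureReal_nonneg ?_
    rw [norm_pow]
    exact pow_le_one₀ (norm_nonneg z) hz
  have hsum := hasSum_integral_of_summable_integral_norm hint hnorm
  simp_rw [hval] at hsum
  have hae : (fun ω => z ^ (σ ω).toNat) =ᵐ[μ]
      fun ω => 1 + (z - 1) * ∑' n : ℕ, if (n : ℕ∞) < σ ω then z ^ n else 0 := by
    filter_upwards [hfin] with ω hω using ENat.pow_toNat_eq z hω
  rw [integral_congr_ae hae, hsum.tsum_eq]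
  -- For `z ≠ 1`, integrability of the series follows by solving the geometric sum formula for it;
  -- this needs division by `z - 1`.
  by_cases hz1 : z = 1
  · simp [hz1]
  · have hz1' : z - 1 ≠ 0 := sub_ne_zero.2 hz1
    have hP : Integrable (fun ω => z ^ (σ ω).toNat) μ := by
      refine Integrable.of_bound ((measurable_of_countable fun k : ℕ => z ^ k).comp
        (measurable_toNat_of_lt hσ)).aestronglyMeasurable 1 (ae_of_all _ fun ω => ?_)
      rw [norm_pow]
      exact pow_le_one₀ (norm_nonneg z) hz
    have hI : Integrable (fun ω => ∑' n : ℕ, if (n : ℕ∞) < σ ω then z ^ n else 0) μ := by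
      refine ((hP.sub (integrable_const 1)).const_mul (z - 1)⁻¹).congr ?_
      filter_upwards [hae] with ω hω
      simp only [Pi.sub_apply, hω]
      field_simp
      ring
    rw [integral_add (integrable_const _) (hI.const_mul _), integral_const_mul]
    simp

end WaitingTime

/-! ### The exponential limit of characteristic functions -/

theorem charFun_expMeasure_one (t : ℝ) :
    charFun (expMeasure 1) t = (1 - t * Complex.I)⁻¹ := by
  rw [charFun_apply_real, expMeasure, gammaMeasure,
    integral_withDensity_eq_integral_toReal_smul (by unfold gammaPDF; fun_prop)
      (ae_of_all _ fun _ => by simp [gammaPDF])]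
  have h : (fun x : ℝ => (gammaPDF 1 1 x).toReal • Complex.exp (t * x * Complex.I)) =
      (Set.Ici 0).indicator fun x : ℝ => Complex.exp ((t * Complex.I - 1) * x) := by
    funext x
    by_cases hx : 0 ≤ x
    · rw [Set.indicator_of_mem (Set.mem_Ici.2 hx), gammaPDF,
        ENNReal.toReal_ofReal (gammaPDFReal_nonneg one_pos one_pos x)]
      simp only [gammaPDFReal, hx, if_true, Real.Gamma_one]
      rw [Complex.real_smul]
      push_cast
      simp only [Real.rpow_one, sub_self, Real.rpow_zero, one_mul, div_one, Complex.ofReal_one]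
      rw [← Complex.exp_add]
      congr 1
      ring
    · rw [Set.indicator_of_notMem (by simpa using hx)]
      simp [gammaPDF, gammaPDFReal, hx]
  rw [h, integral_indicator measurableSet_Ici, integral_Ici_eq_integral_Ioi,
    integral_exp_mul_complex_Ioi (by simp)]
  simp only [Complex.ofReal_zero, mul_zero, Complex.exp_zero]
  rw [neg_div, ← div_neg, neg_sub, one_div]

/-- As `m → ∞`, `(1 - z) * m → -i t`, so the denominator tends to `1 - i t`, while the error is at
most `‖(1 - z) * m‖ ^ 2 * (W / m ^ 2)`, which tends to 0. -/
theorem tendsto_generating_of_mul_eq {m W : ℕ → ℝ} {R φ : ℕ → ℂ} (t : ℝ)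
    (hm : Tendsto m atTop atTop) (hW : Tendsto (fun N => W N / m N ^ 2) atTop (𝓝 0))
    (hR : ∀ᶠ N in atTop, ‖R N‖ ≤ W N)
    (h : ∀ᶠ N in atTop, φ N * ((1 - Complex.exp ((t / m N : ℝ) * Complex.I)) * m N +
      Complex.exp ((t / m N : ℝ) * Complex.I)) = Complex.exp ((t / m N : ℝ) * Complex.I) +
        (1 - Complex.exp ((t / m N : ℝ) * Complex.I)) ^ 2 * R N) :
    Tendsto φ atTop (𝓝 (1 - t * Complex.I)⁻¹) := by
  set z : ℕ → ℂ := fun N => Complex.exp ((t / m N : ℝ) * Complex.I) with hz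
  have hs : Tendsto (fun N => t / m N) atTop (𝓝 0) := tendsto_const_nhds.div_atTop hm
  have hz1 : Tendsto z atTop (𝓝 1) := by
    have : Continuous fun s : ℝ => Complex.exp (s * Complex.I) := by fun_prop
    have h := (this.tendsto 0).comp hs
    rw [Complex.ofReal_zero, zero_mul, Complex.exp_zero] at h
    exact h
  have hderiv : HasDerivAt (fun s : ℝ => Complex.exp ((s * t : ℝ) * Complex.I)) (t * Complex.I) 0 := by
    have h1 : HasDerivAt (fun s : ℝ => ((s * t : ℝ) : ℂ) * Complex.I) (t * Complex.I) 0 := by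
      have := ((hasDerivAt_id (0 : ℝ)).mul_const t).ofReal_comp.mul_const Complex.I
      simpa using this
    simpa using h1.cexp
  have hD : Tendsto (fun N => (1 - z N) * m N) atTop (𝓝 (-(t * Complex.I))) := by
    -- `(z - 1) * m` is the difference quotient at 0 of `s ↦ exp (i s t)` with increment `1 / m`.
    have h0 := hderiv.tendsto_slope_zero_right
    have h1 := h0.comp (tendsto_inv_atTop_nhdsGT_zero.comp hm)
    refine h1.neg.congr fun N => ?_
    simp only [Function.comp_apply, inv_inv, hz, zero_add, zero_mul, Complex.ofReal_zero,
      Complex.exp_zero, Complex.real_smul]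
    rw [div_eq_inv_mul]
    ring
  have hE : Tendsto (fun N => (1 - z N) ^ 2 * R N) atTop (𝓝 0) := by
    have hb : Tendsto (fun N => ‖(1 - z N) * m N‖ ^ 2 * (W N / m N ^ 2)) atTop (𝓝 0) := by
      simpa using (hD.norm.pow 2).mul hW
    refine squeeze_zero_norm' ?_ hb
    filter_upwards [hR, hm.eventually_gt_atTop 0] with N hN hmN
    rw [norm_mul, norm_mul, norm_pow, Complex.norm_real, Real.norm_of_nonneg hmN.le, mul_pow]
    calc ‖1 - z N‖ ^ 2 * ‖R N‖ ≤ ‖1 - z N‖ ^ 2 * W N := by gcongr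
      _ = _ := by field_simp
  have hden : Tendsto (fun N => (1 - z N) * m N + z N) atTop (𝓝 (1 - t * Complex.I)) := by
    convert hD.add hz1 using 2
    ring
  have hne : (1 - t * Complex.I : ℂ) ≠ 0 := by
    intro h0
    simpa using congrArg Complex.re h0
  have hfin := (hz1.add hE).div hden hne
  rw [add_zero, one_div] at hfin
  refine hfin.congr' ?_
  filter_upwards [h, hden.eventually_ne hne] with N hN hN2
  rw [Pi.div_apply, div_eq_iff hN2]
  exact hN.symm

/-! ### Hitting times of finite chains -/

namespace Markov

section Hitting

variable {S : Type*} [Fintype S] [DecidableEq S] [MeasurableSpace S] [MeasurableSingletonClass S]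
  {Q : Matrix.rowStochastic ℝ S} {T : Set S} {x₀ : S} {σ : (ℕ → S) → ℕ∞}

theorem lintegral_hitting (hσ : ∀ ω (n : ℕ), (n : ℕ∞) < σ ω ↔ ω ∈ avoid T n) (h₀ : x₀ ∉ T)
    {h : S → ℝ} (h_nonneg : ∀ x, 0 ≤ h x) (hT : ∀ x ∈ T, h x = 0)
    (hh : ∀ x ∉ T, h x = 1 + Q.1.mulVec h x) :
    ∫⁻ ω, (σ ω : ℝ≥0∞) ∂(chainLaw Q x₀) = ENNReal.ofReal (h x₀) := by
  have hset : ∀ n : ℕ, {ω | (n : ℕ∞) < σ ω} = avoid T n := fun n => Set.ext fun ω => hσ ω n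
  have hP := (Matrix.mem_rowStochastic.1 Q.2).1
  have hS := (hasSum_killedProb hP h₀ h_nonneg hT hh).1
  rw [lintegral_toENNReal_eq_tsum fun n => by rw [hset]; exact measurableSet_avoid T n,
    ← hS.tsum_eq, ENNReal.ofReal_tsum_of_nonneg
      (fun n => Finset.sum_nonneg fun x _ => killedProb_nonneg hP n x) hS.summable]
  refine tsum_congr fun n => ?_
  rw [hset, ← real_avoid Q x₀ T h₀, ofReal_measureReal]

theorem measurable_toNat_hitting {S : Type*} [Finite S] [MeasurableSpace S]
    [MeasurableSingletonClass S] {T : Set S} {σ : (ℕ → S) → ℕ∞}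
    (hσ : ∀ ω (n : ℕ), (n : ℕ∞) < σ ω ↔ ω ∈ avoid T n) :
    Measurable fun ω => (σ ω).toNat :=
  measurable_toNat_of_lt fun n => by
    rw [show {ω | (n : ℕ∞) < σ ω} = avoid T n from Set.ext fun ω => hσ ω n]
    exact measurableSet_avoid T n

theorem ae_ne_top_of_lintegral_ne_top {Ω : Type*} [MeasurableSpace Ω] {μ : Measure Ω}
    {σ : Ω → ℕ∞} (hσ : ∀ n : ℕ, MeasurableSet {ω | (n : ℕ∞) < σ ω})
    (h : ∫⁻ ω, (σ ω : ℝ≥0∞) ∂μ ≠ ⊤) : ∀ᵐ ω ∂μ, σ ω ≠ ⊤ := by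
  have hm : AEMeasurable (fun ω => (σ ω : ℝ≥0∞)) μ := by
    simp_rw [ENat.toENNReal_eq_tsum]
    exact AEMeasurable.tsum fun n =>
      (Measurable.ite (hσ n) measurable_const measurable_const).aemeasurable
  filter_upwards [ae_lt_top' hm h] with ω hω h2
  simp [h2] at hω

theorem exists_charFun_hitting (hσ : ∀ ω (n : ℕ), (n : ℕ∞) < σ ω ↔ ω ∈ avoid T n) (h₀ : x₀ ∉ T)
    {h W : S → ℝ} (h_nonneg : ∀ x, 0 ≤ h x) (hT : ∀ x ∈ T, h x = 0)
    (hh : ∀ x ∉ T, h x = 1 + Q.1.mulVec h x) (hW : ∀ x, 0 ≤ W x)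
    (hhW : ∀ x ∉ T, |h x - h x₀| + Q.1.mulVec W x ≤ W x) (c t : ℝ) :
    ∃ R : ℂ, ‖R‖ ≤ W x₀ ∧
      charFun ((chainLaw Q x₀).map fun ω => ((σ ω).toNat : ℝ) / c) t *
        ((1 - Complex.exp ((t / c : ℝ) * Complex.I)) * h x₀ +
          Complex.exp ((t / c : ℝ) * Complex.I)) =
        Complex.exp ((t / c : ℝ) * Complex.I) +
          (1 - Complex.exp ((t / c : ℝ) * Complex.I)) ^ 2 * R := by
  set z := Complex.exp ((t / c : ℝ) * Complex.I) with hz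
  have hz1 : ‖z‖ ≤ 1 := (Complex.norm_exp_ofReal_mul_I _).le
  have hset : ∀ n : ℕ, {ω | (n : ℕ∞) < σ ω} = avoid T n := fun n => Set.ext fun ω => hσ ω n
  have hP := (Matrix.mem_rowStochastic.1 Q.2).1
  have hS := (hasSum_killedProb hP h₀ h_nonneg hT hh).1
  have hms : ∀ n : ℕ, MeasurableSet {ω | (n : ℕ∞) < σ ω} := fun n => by
    rw [hset]; exact measurableSet_avoid T n
  have hreal : ∀ n : ℕ, (chainLaw Q x₀).real {ω | (n : ℕ∞) < σ ω} =
      ∑ x, killedProb Q.1 T x₀ n x := fun n => by rw [hset, real_avoid Q x₀ T h₀]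
  have hfin : ∀ᵐ ω ∂(chainLaw Q x₀), σ ω ≠ ⊤ := by
    refine ae_ne_top_of_lintegral_ne_top hms ?_
    rw [lintegral_hitting hσ h₀ h_nonneg hT hh]
    exact ENNReal.ofReal_ne_top
  have hint := integral_pow_toNat hms hfin (by simpa only [hreal] using hS.summable) hz1
  simp_rw [hreal] at hint
  have hchar : charFun ((chainLaw Q x₀).map fun ω => ((σ ω).toNat : ℝ) / c) t =
      ∫ ω, z ^ (σ ω).toNat ∂(chainLaw Q x₀) := by
    rw [charFun_apply_real, integral_map]
    · refine integral_congr_ae (ae_of_all _ fun ω => ?_)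
      simp only [hz, ← Complex.exp_nat_mul]
      congr 1
      push_cast
      ring
    · exact ((measurable_of_countable fun k : ℕ => (k : ℝ) / c).comp
        (measurable_toNat_hitting hσ)).aemeasurable
    · exact Continuous.aestronglyMeasurable (by fun_prop)
  rw [hchar, hint]
  exact exists_killedProb_generating hP h₀ h_nonneg hT hh hW hhW hz1

end Hitting

end Markov

/-! ### The walk in terms of functions on the integers -/

namespace AltWells

/-- The probability of a step to the right from `x`. -/
noncomputable def rightProb (N : ℕ) (θ : ℝ) (x : ℤ) : ℝ := if |x| ≤ N then 1 - θ else θ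

/-- The one-step average of `u`, for the walk extended to all of `ℤ`. -/
noncomputable def avg (N : ℕ) (θ : ℝ) (u : ℤ → ℝ) (x : ℤ) : ℝ :=
  rightProb N θ x * u (x + 1) + (1 - rightProb N θ x) * u (x - 1)

theorem notMem_target_iff {N : ℕ} {x : State N} :
    x ∉ target N ↔ -(2 * N : ℤ) < x ∧ (x : ℤ) < 2 * N := by
  have hx2 := x.2
  rw [Set.mem_Icc] at hx2
  simp only [target, Set.mem_ofPred_eq, not_or]
  omega

/-- The arbitrary rows `B` do not enter off the target, so the analysis can forget them and the
subtype of states. -/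
theorem mulVec_eq_avg {N : ℕ} (θ : unitInterval) (B : Matrix.rowStochastic ℝ (State N))
    {x : State N} (hx : x ∉ target N) (u : ℤ → ℝ) :
    (Q N θ B).1.mulVec (fun y => u y) x = avg N θ u x := by
  have h : ∀ y : State N, (Q N θ B).1 x y * u y =
      if (y : ℤ) = x + 1 then rightProb N θ x * u (x + 1)
      else if (y : ℤ) = x - 1 then (1 - rightProb N θ x) * u (x - 1) else 0 := by
    intro y
    simp only [Q, entry, hx, if_false, rightProb]
    split_ifs <;> simp_all
  simp only [Matrix.mulVec, dotProduct, h]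
  exact sum_step hx _ _

theorem lt_τ_iff (N : ℕ) (ω : ℕ → State N) (n : ℕ) :
    (n : ℕ∞) < τ N ω ↔ ω ∈ Markov.avoid (target N) n := by
  rw [← not_le]
  have := hittingAfter_le_iff (u := fun n (ω : ℕ → State N) => ω n) (s := target N) (n := 0)
    (ω := ω) (i := n)
  refine (not_congr this).trans ?_
  simp [Markov.avoid]

/-- `h` solves the equation for the mean time to reach `±2N`. -/
structure IsMeanTime (N : ℕ) (θ : ℝ) (h : ℤ → ℝ) : Prop where
  nonneg : ∀ x : ℤ, -(2 * N) ≤ x → x ≤ 2 * N → 0 ≤ h x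
  left : h (-(2 * N)) = 0
  right : h (2 * N) = 0
  poisson : ∀ x : ℤ, -(2 * N) < x → x < 2 * N → h x = 1 + avg N θ h x

/-- `W` is a Lyapunov function whose drift dominates the fluctuations of `h`. -/
structure IsCorrector (N : ℕ) (θ : ℝ) (h W : ℤ → ℝ) : Prop where
  nonneg : ∀ x : ℤ, -(2 * N) ≤ x → x ≤ 2 * N → 0 ≤ W x
  drift : ∀ x : ℤ, -(2 * N) < x → x < 2 * N → |h x - h 0| + avg N θ W x ≤ W x

section

variable {N : ℕ} {θ : unitInterval} {B : Matrix.rowStochastic ℝ (State N)} {h W : ℤ → ℝ}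

theorem origin_notMem (hN : 1 ≤ N) : origin N ∉ target N := by
  rw [notMem_target_iff]
  simp only [origin]
  omega

theorem IsMeanTime.eq_zero (hh : IsMeanTime N θ h) (x : State N) (hx : x ∈ target N) :
    h x = 0 := by
  rcases hx with hx | hx
  · rw [hx, hh.left]
  · rw [hx, hh.right]

theorem IsMeanTime.eq_mulVec (hh : IsMeanTime N θ h) (x : State N) (hx : x ∉ target N) :
    h x = 1 + (Q N θ B).1.mulVec (fun y => h y) x := by
  rw [mulVec_eq_avg θ B hx]
  exact hh.poisson _ (notMem_target_iff.1 hx).1 (notMem_target_iff.1 hx).2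

theorem IsMeanTime.mean_eq (hN : 1 ≤ N) (hh : IsMeanTime N θ h) :
    mean N θ B = ENNReal.ofReal (h 0) :=
  Markov.lintegral_hitting (lt_τ_iff N) (origin_notMem hN) (h := fun y : State N => h y)
    (fun x => hh.nonneg x x.2.1 x.2.2) hh.eq_zero hh.eq_mulVec

theorem ae_τ_ne_top (h : mean N θ B ≠ ⊤) : ∀ᵐ ω ∂(law N θ B), τ N ω ≠ ⊤ := by
  refine Markov.ae_ne_top_of_lintegral_ne_top (fun n => ?_) h
  rw [show {ω | (n : ℕ∞) < τ N ω} = Markov.avoid (target N) n from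
    Set.ext fun ω => lt_τ_iff N ω n]
  exact Markov.measurableSet_avoid _ n

/-- For `N = 0` the origin is already in the target, a case excluded by the killed-chain lemmas. -/
theorem mean_zero_ne_top (B : Matrix.rowStochastic ℝ (State 0)) : mean 0 θ B ≠ ⊤ := by
  have : ∀ ω : ℕ → State 0, τ 0 ω = 0 := by
    intro ω
    refine nonpos_iff_eq_zero.1 (not_lt.1 fun h => ?_)
    have h1 := (lt_τ_iff 0 ω 0).1 h 0 le_rfl
    rw [notMem_target_iff] at h1
    simp only [Nat.cast_zero] at h1
    omega
  simp [mean, this]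

theorem IsCorrector.exists_charFun (hN : 1 ≤ N) (hh : IsMeanTime N θ h)
    (hW : IsCorrector N θ h W) (t : ℝ) :
    ∃ R : ℂ, ‖R‖ ≤ W 0 ∧
      charFun ((law N θ B).map fun ω => ((τ N ω).toNat : ℝ) / (mean N θ B).toReal) t *
        ((1 - Complex.exp ((t / h 0 : ℝ) * Complex.I)) * h 0 +
          Complex.exp ((t / h 0 : ℝ) * Complex.I)) =
        Complex.exp ((t / h 0 : ℝ) * Complex.I) +
          (1 - Complex.exp ((t / h 0 : ℝ) * Complex.I)) ^ 2 * R := by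
  rw [hh.mean_eq hN, ENNReal.toReal_ofReal (hh.nonneg 0 (by omega) (by omega))]
  refine Markov.exists_charFun_hitting (lt_τ_iff N) (origin_notMem hN)
    (h := fun y : State N => h y) (W := fun y : State N => W y)
    (fun x => hh.nonneg x x.2.1 x.2.2) hh.eq_zero hh.eq_mulVec
    (fun x => hW.nonneg x x.2.1 x.2.2) (fun x hx => ?_) (h 0) t
  rw [mulVec_eq_avg θ B hx]
  exact hW.drift _ (notMem_target_iff.1 hx).1 (notMem_target_iff.1 hx).2

end

theorem tendstoInDistribution_of_corrector {θ : unitInterval}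
    (B : (N : ℕ) → Matrix.rowStochastic ℝ (State N)) {h W : ℕ → ℤ → ℝ}
    (hh : ∀ N ≥ 1, IsMeanTime N θ (h N)) (hW : ∀ N ≥ 1, IsCorrector N θ (h N) (W N))
    (hm : Tendsto (fun N => h N 0) atTop atTop)
    (hlim : Tendsto (fun N => W N 0 / h N 0 ^ 2) atTop (𝓝 0)) :
    (∀ N : ℕ, (∀ᵐ ω ∂(law N θ (B N)), τ N ω ≠ ⊤) ∧ mean N θ (B N) ≠ ⊤) ∧
    TendstoInDistribution
      (fun (N : ℕ) (ω : ℕ → State N) => ((τ N ω).toNat : ℝ) / (mean N θ (B N)).toReal)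
      atTop (id : ℝ → ℝ) (fun N => law N θ (B N)) (expMeasure 1) := by
  have hmean : ∀ N, mean N θ (B N) ≠ ⊤ := by
    intro N
    rcases Nat.eq_zero_or_pos N with rfl | hN
    · exact mean_zero_ne_top _
    · rw [(hh N hN).mean_eq hN]
      exact ENNReal.ofReal_ne_top
  refine ⟨fun N => ⟨ae_τ_ne_top (hmean N), hmean N⟩, ?_⟩
  refine ⟨fun N => ((measurable_of_countable fun k : ℕ => (k : ℝ) / (mean N θ (B N)).toReal).comp
    (Markov.measurable_toNat_hitting (lt_τ_iff N))).aemeasurable, by fun_prop, ?_⟩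
  refine ProbabilityMeasure.tendsto_of_tendsto_charFun fun t => ?_
  simp only [ProbabilityMeasure.coe_mk, Measure.map_id, charFun_expMeasure_one]
  choose! R hR1 hR2 using fun (N : ℕ) (hN : 1 ≤ N) =>
    (hW N hN).exists_charFun (B := B N) hN (hh N hN) t
  exact tendsto_generating_of_mul_eq t hm hlim
    ((eventually_ge_atTop 1).mono hR1) ((eventually_ge_atTop 1).mono hR2)

end AltWells

/-! ### Maximum principle, comparison, and existence of the mean time -/

/-- Consider the leftmost point where a positive maximum is attained. It is interior, its left
neighbour is strictly smaller and has positive weight `1 - r`, which contradicts subharmonicity. -/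
theorem Int.nonpos_of_subharmonic {a b : ℤ} {r D : ℤ → ℝ} (hr0 : ∀ x, 0 ≤ r x) (hr1 : ∀ x, r x < 1)
    (ha : D a ≤ 0) (hb : D b ≤ 0)
    (h : ∀ x, a < x → x < b → D x ≤ r x * D (x + 1) + (1 - r x) * D (x - 1)) {x : ℤ}
    (hax : a ≤ x) (hxb : x ≤ b) : D x ≤ 0 := by
  by_contra! hx
  obtain ⟨y, hy, hmax⟩ := (Finset.Icc a b).exists_max_image D ⟨x, Finset.mem_Icc.2 ⟨hax, hxb⟩⟩
  obtain ⟨w, hw, hmin⟩ := ((Finset.Icc a b).filter fun w => D w = D y).exists_min_image id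
    ⟨y, by simpa using hy⟩
  rw [Finset.mem_filter, Finset.mem_Icc] at hw
  have hpos : 0 < D w := by
    rw [hw.2]; exact hx.trans_le (hmax x (Finset.mem_Icc.2 ⟨hax, hxb⟩))
  have hwa : a < w := lt_of_le_of_ne hw.1.1 (by rintro rfl; linarith)
  have hwb : w < b := lt_of_le_of_ne hw.1.2 (by rintro rfl; linarith)
  have h1 : D (w + 1) ≤ D w := hw.2 ▸ hmax _ (Finset.mem_Icc.2 ⟨by omega, by omega⟩)
  have h2 : D (w - 1) < D w := by
    refine lt_of_le_of_ne (hw.2 ▸ hmax _ (Finset.mem_Icc.2 ⟨by omega, by omega⟩)) fun h3 => ?_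
    have := hmin (w - 1) (Finset.mem_filter.2
      ⟨Finset.mem_Icc.2 ⟨by omega, by omega⟩, h3.trans hw.2⟩)
    simp only [id] at this
    omega
  have h3 := h w hwa hwb
  have h4 := mul_le_mul_of_nonneg_left h1 (hr0 w)
  have h5 := mul_lt_mul_of_pos_left h2 (sub_pos.2 (hr1 w))
  linarith

namespace AltWells

section Comparison

variable {N : ℕ} {θ : ℝ}

theorem rightProb_nonneg (h0 : 0 < θ) (h1 : θ < 1) (x : ℤ) : 0 ≤ rightProb N θ x := by
  unfold rightProb; split_ifs <;> linarith

theorem rightProb_lt_one (h0 : 0 < θ) (h1 : θ < 1) (x : ℤ) : rightProb N θ x < 1 := by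
  unfold rightProb; split_ifs <;> linarith

theorem avg_comb (A k l : ℝ) (u v : ℤ → ℝ) (x : ℤ) :
    avg N θ (fun x => A + k * u x + l * v x) x = A + k * avg N θ u x + l * avg N θ v x := by
  unfold avg; ring

theorem avg_affine (A k : ℝ) (u : ℤ → ℝ) (x : ℤ) :
    avg N θ (fun x => A + k * u x) x = A + k * avg N θ u x := by
  unfold avg; ring

/-- The hypothesis says that `f - g` is subharmonic in the interior. All bounds on the mean time
come from this comparison with explicit barriers. -/
theorem le_of_drift_le (h0 : 0 < θ) (h1 : θ < 1) {a b : ℤ} {f g : ℤ → ℝ} (ha : f a ≤ g a)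
    (hb : f b ≤ g b) (h : ∀ x, a < x → x < b → f x + avg N θ g x ≤ g x + avg N θ f x) {x : ℤ}
    (hax : a ≤ x) (hxb : x ≤ b) : f x ≤ g x := by
  refine sub_nonpos.1 (Int.nonpos_of_subharmonic (r := rightProb N θ) (D := fun x => f x - g x)
    (rightProb_nonneg h0 h1) (rightProb_lt_one h0 h1) (sub_nonpos.2 ha) (sub_nonpos.2 hb)
    (fun y hy1 hy2 => ?_) hax hxb)
  have := h y hy1 hy2
  unfold avg at this
  linarith

end Comparison

section Existence

open Classical in
/-- The extension by zero to `ℤ` of a function on `State N`. -/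
noncomputable def extend {N : ℕ} (u : State N → ℝ) (x : ℤ) : ℝ :=
  if hx : x ∈ Set.Icc (-(2 * N : ℤ)) (2 * N : ℤ) then u ⟨x, hx⟩ else 0

theorem extend_coe {N : ℕ} (u : State N → ℝ) (x : State N) : extend u x = u x := by
  simp [extend]

open Classical in
/-- The operator `1 - P` off the target, and the identity on the target. -/
noncomputable def generator (N : ℕ) (θ : ℝ) : (State N → ℝ) →ₗ[ℝ] (State N → ℝ) where
  toFun u x := if x ∈ target N then u x else u x - avg N θ (extend u) x
  map_add' u v := by
    have : extend (u + v) = extend u + extend v := by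
      funext x; simp only [extend, Pi.add_apply]; split_ifs <;> simp
    funext x
    simp only [this, avg, Pi.add_apply]
    split_ifs <;> ring
  map_smul' c u := by
    have : extend (c • u) = c • extend u := by
      funext x; simp only [extend, Pi.smul_apply, smul_eq_mul]; split_ifs <;> simp
    funext x
    simp only [this, avg, Pi.smul_apply, smul_eq_mul, RingHom.id_apply]
    split_ifs <;> ring

/-- The Dirichlet problem is a square linear system: the maximum principle gives injectivity, hence
solvability, and comparison with 0 gives nonnegativity. -/
theorem exists_isMeanTime (N : ℕ) {θ : ℝ} (h0 : 0 < θ) (h1 : θ < 1) :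
    ∃ h, IsMeanTime N θ h := by
  have hl : (-(2 * N) : ℤ) ∈ Set.Icc (-(2 * N : ℤ)) (2 * N : ℤ) := ⟨le_rfl, by omega⟩
  have hr : (2 * N : ℤ) ∈ Set.Icc (-(2 * N : ℤ)) (2 * N : ℤ) := ⟨by omega, le_rfl⟩
  have hlt : (⟨_, hl⟩ : State N) ∈ target N := Or.inl rfl
  have hrt : (⟨_, hr⟩ : State N) ∈ target N := Or.inr rfl
  have hnt : ∀ (x : ℤ) (hx1 : -(2 * N : ℤ) < x) (hx2 : x < 2 * N),
      (⟨x, Set.mem_Icc.2 ⟨hx1.le, hx2.le⟩⟩ : State N) ∉ target N := fun x hx1 hx2 =>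
    notMem_target_iff.2 ⟨hx1, hx2⟩
  have hel : ∀ u : State N → ℝ, extend u (-(2 * N)) = u ⟨_, hl⟩ := fun u => extend_coe u ⟨_, hl⟩
  have her : ∀ u : State N → ℝ, extend u (2 * N) = u ⟨_, hr⟩ := fun u => extend_coe u ⟨_, hr⟩
  have hinj : Function.Injective (generator N θ) := by
    rw [← LinearMap.ker_eq_bot, LinearMap.ker_eq_bot']
    intro u hu
    have hu' : ∀ x, generator N θ u x = 0 := fun x => congrFun hu x
    have hul : extend u (-(2 * N)) = 0 := by
      have := hu' ⟨_, hl⟩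
      simp only [generator, LinearMap.coe_mk, AddHom.coe_mk, hlt, if_true] at this
      rw [hel, this]
    have hur : extend u (2 * N) = 0 := by
      have := hu' ⟨_, hr⟩
      simp only [generator, LinearMap.coe_mk, AddHom.coe_mk, hrt, if_true] at this
      rw [her, this]
    have hui : ∀ x : ℤ, -(2 * N : ℤ) < x → x < 2 * N → extend u x = avg N θ (extend u) x := by
      intro x hx1 hx2
      have := hu' ⟨x, Set.mem_Icc.2 ⟨hx1.le, hx2.le⟩⟩
      simp only [generator, LinearMap.coe_mk, AddHom.coe_mk, hnt x hx1 hx2, if_false] at this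
      rw [show extend u x = u ⟨x, Set.mem_Icc.2 ⟨hx1.le, hx2.le⟩⟩ from extend_coe u ⟨x, _⟩]
      exact sub_eq_zero.1 this
    have hz : ∀ x, avg N θ (fun _ => 0) x = 0 := fun x => by simp [avg]
    funext x
    rw [← extend_coe u, Pi.zero_apply]
    refine le_antisymm ?_ ?_
    · refine le_of_drift_le (N := N) (g := fun _ => 0) h0 h1 hul.le hur.le (fun y hy1 hy2 => ?_)
        x.2.1 x.2.2
      rw [hz, hui y hy1 hy2]; linarith
    · refine le_of_drift_le (N := N) (f := fun _ => 0) h0 h1 hul.ge hur.ge (fun y hy1 hy2 => ?_)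
        x.2.1 x.2.2
      rw [hz, hui y hy1 hy2]; linarith
  classical
  obtain ⟨u, hu⟩ := (LinearMap.injective_iff_surjective.1 hinj)
    (fun x => if x ∈ target N then 0 else 1)
  have hu' := fun x => congrFun hu x
  have hul : extend u (-(2 * N)) = 0 := by
    have := hu' ⟨_, hl⟩
    simp only [generator, LinearMap.coe_mk, AddHom.coe_mk, hlt, if_true] at this
    rw [hel, this]
  have hur : extend u (2 * N) = 0 := by
    have := hu' ⟨_, hr⟩
    simp only [generator, LinearMap.coe_mk, AddHom.coe_mk, hrt, if_true] at this
    rw [her, this]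
  have hui : ∀ x : ℤ, -(2 * N : ℤ) < x → x < 2 * N → extend u x = 1 + avg N θ (extend u) x := by
    intro x hx1 hx2
    have := hu' ⟨x, Set.mem_Icc.2 ⟨hx1.le, hx2.le⟩⟩
    simp only [generator, LinearMap.coe_mk, AddHom.coe_mk, hnt x hx1 hx2, if_false] at this
    rw [show extend u x = u ⟨x, Set.mem_Icc.2 ⟨hx1.le, hx2.le⟩⟩ from extend_coe u ⟨x, _⟩]
    exact sub_eq_iff_eq_add.1 this
  refine ⟨extend u, fun x hx1 hx2 => ?_, hul, hur, hui⟩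
  refine le_of_drift_le (N := N) (f := fun _ => 0) h0 h1 hul.ge hur.ge (fun y hy1 hy2 => ?_) hx1 hx2
  rw [show avg N θ (fun _ => 0) y = 0 by simp [avg], hui y hy1 hy2]
  linarith

end Existence

/-! ### Reflection symmetry exchanging θ and 1 - θ -/

section Reflection

variable {N : ℕ} {θ : ℝ}

theorem avg_comp_neg (u : ℤ → ℝ) (x : ℤ) :
    avg N θ (fun x => u (-x)) x = avg N (1 - θ) u (-x) := by
  have : rightProb N (1 - θ) (-x) = 1 - rightProb N θ x := by
    unfold rightProb; rw [abs_neg]; split_ifs <;> ring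
  unfold avg
  beta_reduce
  rw [this, show -(x + 1) = -x - 1 by ring, show -(x - 1) = -x + 1 by ring]
  ring

theorem IsMeanTime.comp_neg {h : ℤ → ℝ} (hh : IsMeanTime N (1 - θ) h) :
    IsMeanTime N θ fun x => h (-x) where
  nonneg x h1 h2 := hh.nonneg (-x) (by omega) (by omega)
  left := by rw [neg_neg, hh.right]
  right := hh.left
  poisson x h1 h2 := by rw [avg_comp_neg]; exact hh.poisson (-x) (by omega) (by omega)

theorem IsCorrector.comp_neg {h W : ℤ → ℝ} (hW : IsCorrector N (1 - θ) h W) :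
    IsCorrector N θ (fun x => h (-x)) fun x => W (-x) where
  nonneg x h1 h2 := hW.nonneg (-x) (by omega) (by omega)
  drift x h1 h2 := by rw [avg_comp_neg, neg_zero]; exact hW.drift (-x) (by omega) (by omega)

end Reflection

/-! ### The exponential Lyapunov function of the well -/

section Lyapunov

open Classical in
/-- A function growing exponentially with the distance to the bottom `N` of the well, whose drift
is negative away from `N`. -/
noncomputable def wellFun (N : ℕ) (ρ : ℝ) (x : ℤ) : ℝ :=
  if x < -N then ρ ^ (2 * N : ℤ) * ((3 * N + x) / (2 * N))
  else if x ≤ N then ρ ^ (N - x : ℤ) else ρ ^ (x - N : ℤ)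

variable {N : ℕ} {θ ρ : ℝ}

/-- The branches agree at the junction `-N` (and at `N` below), so a point next to a junction can be
treated with a single formula. -/
theorem wellFun_of_le {x : ℤ} (hN : 1 ≤ N) (hx : x ≤ -N) :
    wellFun N ρ x = ρ ^ (2 * N : ℤ) * ((3 * N + x) / (2 * N)) := by
  unfold wellFun
  split_ifs with h1 h2
  · rfl
  · have : x = -N := by omega
    have hN' : (N : ℝ) ≠ 0 := by positivity
    subst this
    rw [show (N - -N : ℤ) = 2 * N by ring]
    push_cast
    field_simp
    ring
  · omega

theorem wellFun_of_mid {x : ℤ} (hx1 : -N ≤ x) (hx2 : x ≤ N) : wellFun N ρ x = ρ ^ (N - x : ℤ) := by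
  unfold wellFun
  rw [if_neg (by omega), if_pos hx2]

theorem wellFun_of_ge {x : ℤ} (hx : N ≤ x) : wellFun N ρ x = ρ ^ (x - N : ℤ) := by
  unfold wellFun
  split_ifs with h1 h2
  · omega
  · rw [show (N - x : ℤ) = x - N by omega]
  · rfl

theorem wellFun_le (hN : 1 ≤ N) (hρ : 1 ≤ ρ) {x : ℤ} (hx : x ≤ N) :
    wellFun N ρ x ≤ ρ ^ (N - x : ℤ) := by
  rcases le_or_gt (-N : ℤ) x with h | h
  · rw [wellFun_of_mid h hx]
  · have hN' : (0 : ℝ) < N := by positivity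
    have hx' : (x : ℝ) ≤ -N := by exact_mod_cast h.le
    rw [wellFun_of_le hN h.le]
    calc ρ ^ (2 * N : ℤ) * ((3 * N + x) / (2 * N)) ≤ ρ ^ (2 * N : ℤ) * 1 := by
          refine mul_le_mul_of_nonneg_left ?_ (by positivity)
          rw [div_le_one (by positivity)]
          linarith
      _ ≤ ρ ^ (N - x : ℤ) := by
          rw [mul_one]
          exact zpow_le_zpow_right₀ hρ (by omega)

theorem wellFun_nonneg (hρ : 0 ≤ ρ) {x : ℤ} (hx : -(2 * N) ≤ x) : 0 ≤ wellFun N ρ x := by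
  have hx' : (-(2 * N) : ℝ) ≤ x := by exact_mod_cast hx
  have hN' : (0 : ℝ) ≤ N := by positivity
  unfold wellFun
  split_ifs
  · exact mul_nonneg (zpow_nonneg hρ _) (div_nonneg (by linarith) (by linarith))
  · exact zpow_nonneg hρ _
  · exact zpow_nonneg hρ _

/-- On the exponential branches `V` contracts at rate `(1 - 2θ) ^ 2 / 2`. To the left of `-N` the
drift points outwards, so `V` has to decrease to the left; it is linear there, and its relative
decrease is only of order `1 / N`. This is the source of the factor `1 / N`. The bottom is excluded
because `V` has its minimum there. -/
theorem avg_wellFun_le (hN : 1 ≤ N) (h0 : 0 < θ) (h1 : θ < 1 / 2) {x : ℤ} (hx : x ≠ N) :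
    (1 - 2 * θ) ^ 2 / 2 / N * wellFun N (2 * (1 - θ)) x + avg N θ (wellFun N (2 * (1 - θ))) x ≤
      wellFun N (2 * (1 - θ)) x := by
  set ρ := 2 * (1 - θ) with hρ
  have hρ1 : 1 < ρ := by linarith
  have hρ0 : ρ ≠ 0 := by linarith
  have hN' : (1 : ℝ) ≤ N := by exact_mod_cast hN
  have hcN : (1 - 2 * θ) ^ 2 / 2 / N ≤ (1 - 2 * θ) ^ 2 / 2 := div_le_self (by positivity) hN'
  have hpow : ∀ y : ℤ, ρ ^ (y + 1) = ρ ^ y * ρ := fun y => zpow_add_one₀ hρ0 y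
  have hpow' : ∀ y : ℤ, ρ ^ (y - 1) = ρ ^ y / ρ := fun y => zpow_sub_one₀ hρ0 y
  rcases lt_or_ge x (-N) with h | h
  · have hr : rightProb N θ x = θ := by
      unfold rightProb
      rw [if_neg]
      rw [abs_le]; omega
    have hx' : (x : ℝ) ≤ -N := by exact_mod_cast h.le
    unfold avg
    rw [hr, wellFun_of_le hN h.le, wellFun_of_le hN (by omega), wellFun_of_le hN (by omega)]
    push_cast
    have hA : 0 < ρ ^ (2 * N : ℤ) := zpow_pos (by linarith) _
    set A := ρ ^ (2 * N : ℤ)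
    have e : A * ((3 * N + x) / (2 * N)) - (θ * (A * ((3 * N + (x + 1)) / (2 * N))) +
        (1 - θ) * (A * ((3 * N + (x - 1)) / (2 * N)))) = A * ((1 - 2 * θ) / 2 / N) := by
      field_simp
      ring
    have h3 : (1 - 2 * θ) ^ 2 / 2 / N * (A * ((3 * N + x) / (2 * N))) ≤
        (1 - 2 * θ) / 2 / N * (A * 1) := by
      have h4 : (3 * N + x) / (2 * N) ≤ (1 : ℝ) := by
        rw [div_le_one (by positivity)]
        linarith
      have h5 : (1 - 2 * θ) ^ 2 ≤ 1 - 2 * θ := by nlinarith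
      calc (1 - 2 * θ) ^ 2 / 2 / N * (A * ((3 * N + x) / (2 * N))) ≤
          (1 - 2 * θ) ^ 2 / 2 / N * (A * 1) := by gcongr
        _ ≤ (1 - 2 * θ) / 2 / N * (A * 1) := by gcongr
    linarith
  · rcases lt_or_gt_of_ne hx with h2 | h2
    · have hr : rightProb N θ x = 1 - θ := by
        unfold rightProb
        rw [if_pos]
        rw [abs_le]; omega
      have e1 : wellFun N ρ (x + 1) = ρ ^ (N - x : ℤ) / ρ := by
        rw [wellFun_of_mid (by omega) (by omega), ← hpow']
        congr 1
        ring
      -- Only an inequality: at `x = -N` the left neighbour lies on the linear branch, below the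
      -- exponential.
      have e2 : wellFun N ρ (x - 1) ≤ ρ ^ (N - x : ℤ) * ρ := by
        refine (wellFun_le hN hρ1.le (by omega)).trans_eq ?_
        rw [← hpow]
        congr 1
        ring
      have hA : 0 < ρ ^ (N - x : ℤ) := zpow_pos (by linarith) _
      unfold avg
      rw [hr, e1, wellFun_of_mid h h2.le]
      set A := ρ ^ (N - x : ℤ)
      have e3 : (1 - θ) * (A / ρ) = A / 2 := by
        have : 1 - θ = ρ / 2 := by rw [hρ]; ring
        rw [this]; field_simp
      have e4 := mul_le_mul_of_nonneg_left e2 h0.le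
      have e5 := mul_le_mul_of_nonneg_right hcN hA.le
      -- The choice `ρ = 2 (1 - θ)` makes the step towards `N` contribute exactly `1 / 2`, and `1 /
      -- 2 + 2 θ (1 - θ) = 1 - (1 - 2θ) ^ 2 / 2`.
      have e6 : A / 2 + θ * (A * ρ) = A - (1 - 2 * θ) ^ 2 / 2 * A := by rw [hρ]; ring
      rw [e3]
      linarith
    · have hr : rightProb N θ x = θ := by
        unfold rightProb
        rw [if_neg]
        rw [abs_le]; omega
      have e1 : wellFun N ρ (x + 1) = ρ ^ (x - N : ℤ) * ρ := by
        rw [wellFun_of_ge (by omega), ← hpow]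
        congr 1
        ring
      have e2 : wellFun N ρ (x - 1) = ρ ^ (x - N : ℤ) / ρ := by
        rw [wellFun_of_ge (by omega), ← hpow']
        congr 1
        ring
      have hA : 0 < ρ ^ (x - N : ℤ) := zpow_pos (by linarith) _
      unfold avg
      rw [hr, e1, e2, wellFun_of_ge h2.le]
      set A := ρ ^ (x - N : ℤ)
      have e3 : (1 - θ) * (A / ρ) = A / 2 := by
        have : 1 - θ = ρ / 2 := by rw [hρ]; ring
        rw [this]; field_simp
      have e5 := mul_le_mul_of_nonneg_right hcN hA.le
      have e6 : A / 2 + θ * (A * ρ) = A - (1 - 2 * θ) ^ 2 / 2 * A := by rw [hρ]; ring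
      rw [e3]
      linarith

theorem wellFun_bottom : wellFun N ρ N = 1 := by
  rw [wellFun_of_ge le_rfl]; simp

theorem avg_wellFun_bottom (hN : 1 ≤ N) : avg N θ (wellFun N ρ) N = ρ := by
  unfold avg
  rw [wellFun_of_ge (by omega), wellFun_of_mid (by omega) (by omega)]
  simp
  ring

theorem wellFun_origin : wellFun N ρ 0 = ρ ^ N := by
  rw [wellFun_of_mid (by omega) (by omega)]; simp

theorem wellFun_left (hN : 1 ≤ N) : wellFun N ρ (-(2 * N)) = (ρ ^ N) ^ 2 / 2 := by
  have hN' : (0 : ℝ) < N := by positivity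
  rw [wellFun_of_le hN (by omega), mul_comm 2 (N : ℤ), zpow_mul, zpow_natCast]
  push_cast
  rw [show ((3 * N + -(N * 2)) / (2 * N) : ℝ) = 1 / 2 by field_simp; ring]
  norm_cast
  ring

theorem wellFun_right : wellFun N ρ (2 * N) = ρ ^ N := by
  rw [wellFun_of_ge (by omega), show (2 * N - N : ℤ) = N by ring, zpow_natCast]

end Lyapunov

end AltWells

/-! ### Bounds on the mean time and the corrector -/

namespace AltWells

section Bounds

variable {N : ℕ} {θ : ℝ} {h : ℤ → ℝ}

theorem avg_wellFun_le_self (hN : 1 ≤ N) (h0 : 0 < θ) (h1 : θ < 1 / 2) {x : ℤ}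
    (hx1 : -(2 * N) ≤ x) (hx : x ≠ N) :
    avg N θ (wellFun N (2 * (1 - θ))) x ≤ wellFun N (2 * (1 - θ)) x := by
  have h2 := avg_wellFun_le hN h0 h1 hx
  have h3 : 0 ≤ (1 - 2 * θ) ^ 2 / 2 / N * wellFun N (2 * (1 - θ)) x :=
    mul_nonneg (by positivity) (wellFun_nonneg (by linarith) hx1)
  linarith

/-- Away from `N` the walk drifts at speed `1 - 2θ` to the bottom or out of the interval. The
barrier is a tent with peak at `-N` on the left of `N`, and a linear function on the right. -/
theorem IsMeanTime.le_bottom_add (hh : IsMeanTime N θ h) (hN : 1 ≤ N) (h0 : 0 < θ) (h1 : θ < 1 / 2)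
    {x : ℤ} (hx1 : -(2 * N) ≤ x) (hx2 : x ≤ 2 * N) : h x ≤ h N + 2 * N / (1 - 2 * θ) := by
  have hδ : 0 < 1 - 2 * θ := by linarith
  have hH : 0 ≤ h N := hh.nonneg N (by omega) (by omega)
  have hN0 : (0 : ℝ) ≤ N := by positivity
  rcases le_total x N with hx | hx
  · have key : h x ≤ h N + (1 - 2 * θ)⁻¹ * (2 * N - |(x : ℝ) + N|) := by
      refine le_of_drift_le (N := N) (a := -(2 * N)) (b := N)
        (g := fun x => h N + (1 - 2 * θ)⁻¹ * (2 * N - |(x : ℝ) + N|)) h0 (by linarith) ?_ ?_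
        (fun y hy1 hy2 => ?_) hx1 hx
      · rw [hh.left]
        push_cast
        rw [show (-(2 * N) + N : ℝ) = -N by ring, abs_neg, abs_of_nonneg hN0]
        have : 0 ≤ (1 - 2 * θ)⁻¹ * (2 * N - N) := mul_nonneg (by positivity) (by linarith)
        linarith
      · push_cast
        rw [abs_of_nonneg (by linarith : (0 : ℝ) ≤ N + N)]
        apply le_of_eq
        ring
      · rw [avg_affine, hh.poisson y hy1 (by omega)]
        have : (1 - 2 * θ)⁻¹ * (1 - 2 * θ) ≤ (1 - 2 * θ)⁻¹ * (2 * N - |(y : ℝ) + N| -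
            avg N θ (fun y => 2 * N - |(y : ℝ) + N|) y) := by
          refine mul_le_mul_of_nonneg_left ?_ (by positivity)
          unfold avg
          push_cast
          rcases lt_trichotomy y (-N) with hy | hy | hy
          · have hr : rightProb N θ y = θ := by
              unfold rightProb; rw [if_neg]; rw [abs_le]; omega
            have hy' : (y : ℝ) + 1 ≤ -N := by exact_mod_cast hy
            rw [hr, abs_of_nonpos (by linarith : (y : ℝ) + N ≤ 0),
              abs_of_nonpos (by linarith : (y : ℝ) + 1 + N ≤ 0),
              abs_of_nonpos (by linarith : (y : ℝ) - 1 + N ≤ 0)]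
            linarith
          -- At the peak both neighbours are lower by 1, so the decrease is 1, more than the
          -- required `1 - 2θ`.
          · subst hy
            push_cast
            rw [show (-N + N : ℝ) = 0 by ring, show (-N + 1 + N : ℝ) = 1 by ring,
              show (-N - 1 + N : ℝ) = -1 by ring, abs_zero, abs_neg, abs_one]
            linarith
          · have hr : rightProb N θ y = 1 - θ := by
              unfold rightProb; rw [if_pos]; rw [abs_le]; omega
            have hy' : (-N : ℝ) + 1 ≤ y := by exact_mod_cast hy
            rw [hr, abs_of_nonneg (by linarith : 0 ≤ (y : ℝ) + N),
              abs_of_nonneg (by linarith : 0 ≤ (y : ℝ) + 1 + N),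
              abs_of_nonneg (by linarith : 0 ≤ (y : ℝ) - 1 + N)]
            linarith
        rw [inv_mul_cancel₀ hδ.ne'] at this
        linarith
    have : (1 - 2 * θ)⁻¹ * (2 * N - |(x : ℝ) + N|) ≤ 2 * N / (1 - 2 * θ) := by
      rw [div_eq_inv_mul]
      refine mul_le_mul_of_nonneg_left ?_ (by positivity)
      linarith [abs_nonneg ((x : ℝ) + N)]
    linarith
  · have key : h x ≤ h N + (1 - 2 * θ)⁻¹ * ((x : ℝ) - N) := by
      refine le_of_drift_le (N := N) (a := N) (b := 2 * N)
        (g := fun x => h N + (1 - 2 * θ)⁻¹ * ((x : ℝ) - N)) h0 (by linarith) ?_ ?_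
        (fun y hy1 hy2 => ?_) hx hx2
      · simp
      · rw [hh.right]
        push_cast
        have : 0 ≤ (1 - 2 * θ)⁻¹ * (2 * N - N) := mul_nonneg (by positivity) (by linarith)
        linarith
      · rw [avg_affine, hh.poisson y (by omega) hy2]
        have hr : rightProb N θ y = θ := by
          unfold rightProb; rw [if_neg]; rw [abs_le]; omega
        have : avg N θ (fun y => (y : ℝ) - N) y = y - N - (1 - 2 * θ) := by
          unfold avg
          rw [hr]
          push_cast
          ring
        rw [this, mul_sub _ _ (1 - 2 * θ), inv_mul_cancel₀ hδ.ne']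
        linarith
    have : (1 - 2 * θ)⁻¹ * ((x : ℝ) - N) ≤ 2 * N / (1 - 2 * θ) := by
      rw [div_eq_inv_mul]
      refine mul_le_mul_of_nonneg_left ?_ (by positivity)
      have : (x : ℝ) ≤ 2 * N := by exact_mod_cast hx2
      linarith
    linarith

/-- `h N - k V` is a subharmonic barrier away from the bottom, so the two sides of `N` are treated
separately. -/
theorem IsMeanTime.sub_wellFun_le (hh : IsMeanTime N θ h) (hN : 1 ≤ N) (h0 : 0 < θ)
    (h1 : θ < 1 / 2) {a b : ℤ} (hab : (a = -(2 * N) ∧ b = N) ∨ (a = N ∧ b = 2 * N)) {k : ℝ}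
    (hk : 0 ≤ k) (ha : h N - k * wellFun N (2 * (1 - θ)) a ≤ h a)
    (hb : h N - k * wellFun N (2 * (1 - θ)) b ≤ h b) {x : ℤ} (hax : a ≤ x) (hxb : x ≤ b) :
    h N - k * wellFun N (2 * (1 - θ)) x ≤ h x := by
  have key : h N + (-k) * wellFun N (2 * (1 - θ)) x ≤ h x := by
    refine le_of_drift_le (N := N) (a := a) (b := b)
      (f := fun x => h N + (-k) * wellFun N (2 * (1 - θ)) x) h0 (by linarith) (by linarith)
      (by linarith) (fun y hy1 hy2 => ?_) hax hxb
    rw [avg_affine, hh.poisson y (by omega) (by omega)]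
    have := mul_le_mul_of_nonneg_left
      (avg_wellFun_le_self (x := y) hN h0 h1 (by omega) (by omega)) hk
    linarith
  linarith

/-- The constant is fixed by `V (-2N) = ρ ^ (2N) / 2`, which brings the barrier to 0 at the left
end. The square in the denominator matters: since `V 0 = ρ ^ N`, it makes `h 0` close to `h N`. -/
theorem IsMeanTime.sub_le_of_le_bottom (hh : IsMeanTime N θ h) (hN : 1 ≤ N) (h0 : 0 < θ)
    (h1 : θ < 1 / 2) {x : ℤ} (hx1 : -(2 * N) ≤ x) (hx2 : x ≤ N) :
    h N - 2 * h N / ((2 * (1 - θ)) ^ N) ^ 2 * wellFun N (2 * (1 - θ)) x ≤ h x := by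
  have hH : 0 ≤ h N := hh.nonneg N (by omega) (by omega)
  have hr : 0 < (2 * (1 - θ)) ^ N := pow_pos (by linarith) _
  refine hh.sub_wellFun_le hN h0 h1 (Or.inl ⟨rfl, rfl⟩) (by positivity) ?_ ?_ hx1 hx2
  · rw [hh.left, wellFun_left hN]
    apply le_of_eq
    field_simp
    ring
  · rw [wellFun_bottom, mul_one]
    have : 0 ≤ 2 * h N / ((2 * (1 - θ)) ^ N) ^ 2 := by positivity
    linarith

theorem IsMeanTime.sub_le (hh : IsMeanTime N θ h) (hN : 1 ≤ N) (h0 : 0 < θ)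
    (h1 : θ < 1 / 2) {x : ℤ} (hx1 : -(2 * N) ≤ x) (hx2 : x ≤ 2 * N) :
    h N - 2 * h N / (2 * (1 - θ)) ^ N * wellFun N (2 * (1 - θ)) x ≤ h x := by
  have hH : 0 ≤ h N := hh.nonneg N (by omega) (by omega)
  have hr : 1 ≤ (2 * (1 - θ)) ^ N := one_le_pow₀ (by linarith)
  have hV : 0 ≤ wellFun N (2 * (1 - θ)) x := wellFun_nonneg (by linarith) hx1
  rcases le_total x N with hx | hx
  · refine le_trans ?_ (hh.sub_le_of_le_bottom hN h0 h1 hx1 hx)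
    have : 2 * h N / ((2 * (1 - θ)) ^ N) ^ 2 ≤ 2 * h N / (2 * (1 - θ)) ^ N :=
      div_le_div_of_nonneg_left (by positivity) (by positivity) (by nlinarith)
    have := mul_le_mul_of_nonneg_right this hV
    linarith
  · refine hh.sub_wellFun_le hN h0 h1 (Or.inr ⟨rfl, rfl⟩) (by positivity) ?_ ?_ hx hx2
    · rw [wellFun_bottom, mul_one]
      have : 0 ≤ 2 * h N / (2 * (1 - θ)) ^ N := by positivity
      linarith
    · rw [hh.right, wellFun_right, div_mul_cancel₀ _ (by positivity)]
      linarith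

theorem IsMeanTime.le_origin (hh : IsMeanTime N θ h) (hN : 1 ≤ N) (h0 : 0 < θ)
    (h1 : θ < 1 / 2) : h N - 2 * h N / (2 * (1 - θ)) ^ N ≤ h 0 := by
  have hr : 0 < (2 * (1 - θ)) ^ N := pow_pos (by linarith) _
  refine le_of_eq_of_le ?_ (hh.sub_le_of_le_bottom (x := 0) hN h0 h1 (by omega) (by omega))
  rw [wellFun_origin]
  field_simp

/-- The barrier is `(ρ ^ N - V) / (1 - 2θ)`. At the bottom `V` rises on average by `ρ - 1 = 1 - 2θ`,
and elsewhere it does not rise, so the barrier loses at most 1 per step. It vanishes at `2N`, and `ρ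
^ N ≥ 2` makes it nonpositive at `-2N`. -/
theorem IsMeanTime.pow_le_bottom (hh : IsMeanTime N θ h) (hN : 1 ≤ N) (h0 : 0 < θ)
    (h1 : θ < 1 / 2) (hr : 2 ≤ (2 * (1 - θ)) ^ N) :
    ((2 * (1 - θ)) ^ N - 1) / (1 - 2 * θ) ≤ h N := by
  have hδ : 0 < 1 - 2 * θ := by linarith
  have key : (2 * (1 - θ)) ^ N / (1 - 2 * θ) +
      (-(1 - 2 * θ)⁻¹) * wellFun N (2 * (1 - θ)) N ≤ h N := by
    refine le_of_drift_le (N := N) (a := -(2 * N)) (b := 2 * N)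
      (f := fun x => (2 * (1 - θ)) ^ N / (1 - 2 * θ) +
        (-(1 - 2 * θ)⁻¹) * wellFun N (2 * (1 - θ)) x) h0 (by linarith) ?_ ?_
      (fun y hy1 hy2 => ?_) (by omega) (by omega)
    · rw [hh.left, wellFun_left hN, div_eq_inv_mul _ (1 - 2 * θ), neg_mul, ← sub_eq_add_neg,
        ← mul_sub]
      exact mul_nonpos_of_nonneg_of_nonpos (by positivity) (by nlinarith)
    · rw [hh.right, wellFun_right, div_eq_inv_mul]
      apply le_of_eq
      ring
    · rw [avg_affine, hh.poisson y hy1 hy2]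
      have : (1 - 2 * θ)⁻¹ * (avg N θ (wellFun N (2 * (1 - θ))) y - wellFun N (2 * (1 - θ)) y) ≤
          (1 - 2 * θ)⁻¹ * (1 - 2 * θ) := by
        refine mul_le_mul_of_nonneg_left ?_ (by positivity)
        by_cases hy : y = N
        · rw [hy, wellFun_bottom, avg_wellFun_bottom hN]
          linarith
        · linarith [avg_wellFun_le_self hN h0 h1 hy1.le hy]
      rw [inv_mul_cancel₀ hδ.ne'] at this
      linarith
  rw [wellFun_bottom] at key
  rw [sub_div, one_div]
  linarith

/-- The Lyapunov function which controls the fluctuations of the mean hitting time `h`. -/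
noncomputable def corrector (N : ℕ) (θ : ℝ) (h : ℤ → ℝ) (x : ℤ) : ℝ :=
  0 + 2 * h N / (2 * (1 - θ)) ^ N * (N / ((1 - 2 * θ) ^ 2 / 2)) * wellFun N (2 * (1 - θ)) x +
    (2 * (2 * h N / (2 * (1 - θ)) ^ N * (N / ((1 - 2 * θ) ^ 2 / 2))) +
      (2 * h N / (2 * (1 - θ)) ^ N + 4 * N / (1 - 2 * θ))) * h x

/-- The multiple of `V` pays for the part of `|h - h 0|` proportional to `V`, except for a bounded
defect at the bottom. Since `h` loses exactly 1 per step, a multiple of `h` pays for that defect and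
for the constant part of the fluctuations. -/
theorem IsMeanTime.isCorrector (hh : IsMeanTime N θ h) (hN : 1 ≤ N) (h0 : 0 < θ)
    (h1 : θ < 1 / 2) : IsCorrector N θ h (corrector N θ h) := by
  have hδ : 0 < 1 - 2 * θ := by linarith
  have hH : 0 ≤ h N := hh.nonneg N (by omega) (by omega)
  have hr : 0 < (2 * (1 - θ)) ^ N := pow_pos (by linarith) _
  have hN' : (1 : ℝ) ≤ N := by exact_mod_cast hN
  have hc : 0 < (1 - 2 * θ) ^ 2 / 2 := by positivity
  have hc1 : (1 - 2 * θ) ^ 2 / 2 ≤ 1 := by nlinarith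
  refine ⟨fun x hx1 hx2 => ?_, fun x hx1 hx2 => ?_⟩
  · have h2 := hh.nonneg x hx1 hx2
    have h3 : 0 ≤ wellFun N (2 * (1 - θ)) x := wellFun_nonneg (by linarith) hx1
    unfold corrector
    positivity
  · have e1 := hh.le_bottom_add hN h0 h1 hx1.le hx2.le
    have e2 := hh.le_bottom_add (x := 0) hN h0 h1 (by omega) (by omega)
    have e3 := hh.sub_le hN h0 h1 hx1.le hx2.le
    have e4 := hh.le_origin hN h0 h1
    have e5 : 0 ≤ 2 * N / (1 - 2 * θ) := by positivity
    have e6 : 4 * N / (1 - 2 * θ) = 2 * (2 * N / (1 - 2 * θ)) := by ring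
    have e7 := hh.poisson x hx1 hx2
    have hV : 0 ≤ wellFun N (2 * (1 - θ)) x := wellFun_nonneg (by linarith) hx1.le
    have hq : 0 ≤ 2 * h N / (2 * (1 - θ)) ^ N := by positivity
    have hqV := mul_nonneg hq hV
    -- The extra `2` is needed only at `x = N`, where `1 + K * ρ ≤ 3 * K` with `K = N / ((1 - 2θ) ^
    -- 2 / 2) ≥ 1` and `ρ < 2`.
    have hdrift : wellFun N (2 * (1 - θ)) x +
        N / ((1 - 2 * θ) ^ 2 / 2) * (avg N θ (wellFun N (2 * (1 - θ))) x) ≤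
        N / ((1 - 2 * θ) ^ 2 / 2) * (wellFun N (2 * (1 - θ)) x + 2) := by
      by_cases hx : x = N
      · rw [hx, wellFun_bottom, avg_wellFun_bottom hN]
        have : 1 ≤ N / ((1 - 2 * θ) ^ 2 / 2) := by
          rw [le_div_iff₀ hc]; linarith
        nlinarith
      · have h3 := mul_le_mul_of_nonneg_left (avg_wellFun_le hN h0 h1 hx)
          (by positivity : 0 ≤ N / ((1 - 2 * θ) ^ 2 / 2))
        have h4 : N / ((1 - 2 * θ) ^ 2 / 2) * ((1 - 2 * θ) ^ 2 / 2 / N * wellFun N (2 * (1 - θ)) x)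
            = wellFun N (2 * (1 - θ)) x := by
          field_simp
        have h5 : 0 ≤ N / ((1 - 2 * θ) ^ 2 / 2) := by positivity
        rw [mul_add, h4] at h3
        linarith
    have hdrift2 := mul_le_mul_of_nonneg_left hdrift hq
    have habs : |h x - h 0| ≤ 2 * h N / (2 * (1 - θ)) ^ N * wellFun N (2 * (1 - θ)) x +
        (2 * h N / (2 * (1 - θ)) ^ N + 4 * N / (1 - 2 * θ)) := by
      rw [abs_le]
      constructor <;> linarith
    have hc2 : corrector N θ h x - avg N θ (corrector N θ h) x =
        2 * h N / (2 * (1 - θ)) ^ N * (N / ((1 - 2 * θ) ^ 2 / 2)) *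
          (wellFun N (2 * (1 - θ)) x - avg N θ (wellFun N (2 * (1 - θ))) x + 2) +
        (2 * h N / (2 * (1 - θ)) ^ N + 4 * N / (1 - 2 * θ)) := by
      unfold corrector
      rw [avg_comb, e7]
      ring
    linarith

theorem IsMeanTime.bounds_of_large (hh : IsMeanTime N θ h) (hN : 1 ≤ N) (h0 : 0 < θ)
    (h1 : θ < 1 / 2) (hr : 4 ≤ (2 * (1 - θ)) ^ N) :
    (2 * (1 - θ)) ^ N / 4 ≤ h 0 ∧ h N ≤ 2 * h 0 := by
  have hδ : 0 < 1 - 2 * θ := by linarith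
  have hH : 0 ≤ h N := hh.nonneg N (by omega) (by omega)
  have e1 := hh.pow_le_bottom hN h0 h1 (by linarith)
  have e2 := hh.le_origin hN h0 h1
  have e3 : (2 * (1 - θ)) ^ N - 1 ≤ ((2 * (1 - θ)) ^ N - 1) / (1 - 2 * θ) :=
    le_div_self (by linarith) hδ (by linarith)
  have e4 : 2 * h N / (2 * (1 - θ)) ^ N ≤ 2 * h N / 4 :=
    div_le_div_of_nonneg_left (by positivity) (by norm_num) hr
  constructor <;> linarith

/-- With `h N ≤ 2 * h 0` and `1 ≤ 4 * h 0 / ρ ^ N`, each of the four terms of the corrector at 0 is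
`O(N * h 0 ^ 2 / ρ ^ N)`. -/
theorem IsMeanTime.corrector_div_le (hh : IsMeanTime N θ h) (hN : 1 ≤ N) (h0 : 0 < θ)
    (h1 : θ < 1 / 2) (hr : 4 ≤ (2 * (1 - θ)) ^ N) :
    corrector N θ h 0 / h 0 ^ 2 ≤
      (24 / ((1 - 2 * θ) ^ 2 / 2) + 4 + 16 / (1 - 2 * θ)) * (N * ((2 * (1 - θ))⁻¹) ^ N) := by
  have hδ : 0 < 1 - 2 * θ := by linarith
  obtain ⟨hm, hH2⟩ := hh.bounds_of_large hN h0 h1 hr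
  have hN' : (1 : ℝ) ≤ N := by exact_mod_cast hN
  have hc : 0 < (1 - 2 * θ) ^ 2 / 2 := by positivity
  unfold corrector
  rw [wellFun_origin, inv_pow]
  set r := (2 * (1 - θ)) ^ N
  set c := (1 - 2 * θ) ^ 2 / 2
  set m := h 0
  set H := h N
  have hr0 : 0 < r := by linarith
  have hm0 : 0 < m := by linarith
  have hmr : m ≤ 4 * m ^ 2 / r := by
    rw [le_div_iff₀ hr0]; nlinarith
  rw [div_le_iff₀ (by positivity)]
  have t1 : 2 * H / r * (N / c) * r ≤ 4 * (N / c) * (4 * m ^ 2 / r) := by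
    calc 2 * H / r * (N / c) * r = 2 * (N / c) * H := by field_simp
      _ ≤ 2 * (N / c) * (2 * m) := by gcongr
      _ = 4 * (N / c) * m := by ring
      _ ≤ _ := by gcongr
  have t2 : 2 * (2 * H / r * (N / c)) * m ≤ 8 * (N / c) * m ^ 2 / r := by
    calc 2 * (2 * H / r * (N / c)) * m ≤ 2 * (2 * (2 * m) / r * (N / c)) * m := by gcongr
      _ = _ := by ring
  have t3 : 2 * H / r * m ≤ 4 * N * m ^ 2 / r := by
    calc 2 * H / r * m ≤ 2 * (2 * m) / r * m := by gcongr
      _ = 4 * 1 * m ^ 2 / r := by ring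
      _ ≤ _ := by gcongr
  have t4 : 4 * N / (1 - 2 * θ) * m ≤ 4 * N / (1 - 2 * θ) * (4 * m ^ 2 / r) := by gcongr
  have e : (24 / c + 4 + 16 / (1 - 2 * θ)) * (N * r⁻¹) * m ^ 2 =
      4 * (N / c) * (4 * m ^ 2 / r) + 8 * (N / c) * m ^ 2 / r + 4 * N * m ^ 2 / r +
        4 * N / (1 - 2 * θ) * (4 * m ^ 2 / r) := by
    ring
  rw [e]
  linarith

end Bounds

/-! ### Conclusion -/

theorem exists_corrector_of_lt_half {θ : ℝ} (h0 : 0 < θ) (h1 : θ < 1 / 2) :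
    ∃ h W : ℕ → ℤ → ℝ, (∀ N ≥ 1, IsMeanTime N θ (h N)) ∧
      (∀ N ≥ 1, IsCorrector N θ (h N) (W N)) ∧ Tendsto (fun N => h N 0) atTop atTop ∧
      Tendsto (fun N => W N 0 / h N 0 ^ 2) atTop (𝓝 0) := by
  choose h hh using fun N : ℕ => exists_isMeanTime N h0 (by linarith : θ < 1)
  have hρ : 1 < 2 * (1 - θ) := by linarith
  have hpow : Tendsto (fun N : ℕ => (2 * (1 - θ)) ^ N) atTop atTop :=
    tendsto_pow_atTop_atTop_of_one_lt hρ
  have hC : ∀ N ≥ 1, IsCorrector N θ (h N) (corrector N θ (h N)) := fun N hN =>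
    (hh N).isCorrector hN h0 h1
  refine ⟨h, fun N => corrector N θ (h N), fun N _ => hh N, hC, ?_, ?_⟩
  · refine tendsto_atTop_mono' atTop ?_ (hpow.atTop_div_const (by norm_num : (0 : ℝ) < 4))
    filter_upwards [hpow.eventually_ge_atTop 4, eventually_ge_atTop 1] with N hr hN
    exact ((hh N).bounds_of_large hN h0 h1 hr).1
  · have hlim := (tendsto_self_mul_const_pow_of_lt_one (r := (2 * (1 - θ))⁻¹) (by positivity)
      (inv_lt_one_of_one_lt₀ hρ)).const_mul
        (24 / ((1 - 2 * θ) ^ 2 / 2) + 4 + 16 / (1 - 2 * θ))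
    rw [mul_zero] at hlim
    refine tendsto_of_tendsto_of_tendsto_of_le_of_le' tendsto_const_nhds hlim ?_ ?_
    · filter_upwards [eventually_ge_atTop 1] with N hN
      exact div_nonneg ((hC N hN).nonneg 0 (by omega) (by omega)) (sq_nonneg _)
    · filter_upwards [hpow.eventually_ge_atTop 4, eventually_ge_atTop 1] with N hr hN
      exact (hh N).corrector_div_le hN h0 h1 hr

theorem exists_corrector {θ : ℝ} (h0 : 0 < θ) (h1 : θ < 1) (h2 : θ ≠ 1 / 2) :
    ∃ h W : ℕ → ℤ → ℝ, (∀ N ≥ 1, IsMeanTime N θ (h N)) ∧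
      (∀ N ≥ 1, IsCorrector N θ (h N) (W N)) ∧ Tendsto (fun N => h N 0) atTop atTop ∧
      Tendsto (fun N => W N 0 / h N 0 ^ 2) atTop (𝓝 0) := by
  rcases lt_or_gt_of_ne h2 with h | h
  · exact exists_corrector_of_lt_half h0 h
  · obtain ⟨f, W, hf, hW, hm, hl⟩ :=
      exists_corrector_of_lt_half (θ := 1 - θ) (by linarith) (by linarith)
    exact ⟨fun N x => f N (-x), fun N x => W N (-x), fun N hN => (hf N hN).comp_neg,
      fun N hN => (hW N hN).comp_neg, by simpa using hm, by simpa using hl⟩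

end AltWells

theorem mainTheorem6 (θ : unitInterval) (hθ0 : θ ≠ 0) (hθ1 : θ ≠ 1) (hθ : (θ : ℝ) ≠ 1 / 2)
    (B : (N : ℕ) → Matrix.rowStochastic ℝ (AltWells.State N)) :
    (∀ N : ℕ, (∀ᵐ ω ∂(AltWells.law N θ (B N)), AltWells.τ N ω ≠ ⊤) ∧
      AltWells.mean N θ (B N) ≠ ⊤) ∧
    TendstoInDistribution
      (fun (N : ℕ) (ω : ℕ → AltWells.State N) =>
        ((AltWells.τ N ω).toNat : ℝ) / (AltWells.mean N θ (B N)).toReal)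
      atTop (id : ℝ → ℝ) (fun N => AltWells.law N θ (B N)) (expMeasure 1) := by
  obtain ⟨h, W, hh, hW, hm, hl⟩ := AltWells.exists_corrector
    (unitInterval.pos_iff_ne_zero.2 hθ0) (unitInterval.lt_one_iff_ne_one.2 hθ1) hθ
  exact AltWells.tendstoInDistribution_of_corrector B hh hW hm hl
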